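/- Let $G$ be a compact metric tree, i.e. a connected metric graph without cycles, made of finitely many (at least one) edges $e$, each a compact interval $[0,|e|]$ of length $|e|>0$, glued together at vertices. For a bounded measurable potential $q:G\to\mathbb R$ let $H_q u=-u''+qu$ be the Schrödinger operator in $L^2(G)$ with standard vertex conditions (functions in its domain are continuous on $G$, belong to $W^{2,2}$ on every edge, and at every vertex the sum of the derivatives along the incident edges, taken in the direction into the vertex, is zero). Let $\lambda_1(G,q)<\lambda_2(G,q)\le\dots$ be its eigenvalues, repeated according to multiplicity, and let $\Gamma[q]=\lambda_2(G,q)-\lambda_1(G,q)$ be the fundamental gap. For $M>0$ let $C_{G,M}$ be the set of all functions $q:G\to\mathbb R$ with $0\le q\le M$ that are convex on every path from one leaf (vertex of degree one) of $G$ to another leaf, the path being regarded as an interval parametrized by arc length. If the eigenvalue $\lambda_2(G,0)$ of the Laplacian ($q=0$) has multiplicity at least two, then for every $M>0$ the potential $q=0$ does not minimize $\Gamma[q]$ among $q\in C_{G,M}$. -/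

import Mathlib

open MeasureTheory

noncomputable section

/-- A compact metric graph: finitely many edges `e`, each identified with the interval
`[0, len e]`, whose ends are partitioned into vertices. The end `(e, false)` is the point `0` of
`e`, the end `(e, true)` is the point `len e`, and `vert a` is the class (vertex) of the end `a`.
Loops and parallel edges are allowed. -/
structure MetricGraph (V E : Type*) where
  len : E → ℝ
  len_pos : ∀ e, 0 < len e
  vert : E × Bool → V
  vert_surjective : Function.Surjective vert

namespace MetricGraph

variable {V E : Type*} (G : MetricGraph V E)

lemma len_nonneg (e : E) : 0 ≤ G.len e := (G.len_pos e).le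

/-- The disjoint union of the edges. -/
abbrev PrePoint : Type _ := Σ e : E, Set.Icc (0 : ℝ) (G.len e)

/-- An end of an edge as a point of that edge. -/
def preEnd (a : E × Bool) : G.PrePoint :=
  match a with
  | (e, false) => ⟨e, ⟨0, le_rfl, G.len_nonneg e⟩⟩
  | (e, true) => ⟨e, ⟨G.len e, G.len_nonneg e, le_rfl⟩⟩

lemma preEnd_injective : Function.Injective G.preEnd := by
  rintro ⟨e, b⟩ ⟨e', b'⟩ h
  have he : e = e' := by
    have := congrArg Sigma.fst h
    cases b <;> cases b' <;> exact this
  subst he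
  have hl := G.len_pos e
  cases b <;> cases b' <;> simp only [preEnd, Sigma.mk.injEq, heq_eq_eq, true_and] at h
  · rfl
  · exact absurd (congrArg Subtype.val h) hl.ne
  · exact absurd (congrArg Subtype.val h) hl.ne'
  · rfl

/-- Two points of the disjoint union are glued when they are equal, or when they are ends of edges
that belong to the same vertex. -/
def gluing : Setoid G.PrePoint where
  r p p' := p = p' ∨ ∃ a b, p = G.preEnd a ∧ p' = G.preEnd b ∧ G.vert a = G.vert b
  iseqv :=
    { refl := fun _ => Or.inl rfl
      symm := by
        rintro p p' (h | ⟨a, b, h1, h2, h3⟩)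
        · exact Or.inl h.symm
        · exact Or.inr ⟨b, a, h2, h1, h3.symm⟩
      trans := by
        rintro p p' p'' (h | ⟨a, b, h1, h2, h3⟩) (k | ⟨c, d, k1, k2, k3⟩)
        · exact Or.inl (h.trans k)
        · exact Or.inr ⟨c, d, h.trans k1, k2, k3⟩
        · exact Or.inr ⟨a, b, h1, k.symm.trans h2, h3⟩
        · have hbc : b = c := G.preEnd_injective (h2.symm.trans k1)
          exact Or.inr ⟨a, d, h1, k2, h3.trans (hbc ▸ k3)⟩ }

/-- The points of the metric graph, with the quotient topology (which, the graph being finite, is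
the topology of the path metric). -/
def Point : Type _ := Quotient G.gluing

instance : TopologicalSpace G.Point := inferInstanceAs (TopologicalSpace (Quotient G.gluing))

/-- The point of `G` with coordinate `x` on the edge `e`. -/
def pt (e : E) (x : Set.Icc (0 : ℝ) (G.len e)) : G.Point := Quotient.mk G.gluing ⟨e, x⟩

/-- The point of `G` represented by the end `a` of an edge, that is, the vertex `G.vert a`. -/
def endPt (a : E × Bool) : G.Point := Quotient.mk G.gluing (G.preEnd a)

/-- The restriction `u_e` of a function `u` on `G` to the edge `e`, as a function on `[0, len e]`
(continued by its end values to the real line; only its values on `[0, len e]` are used). -/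
def onEdge (u : G.Point → ℝ) (e : E) : ℝ → ℝ :=
  Set.IccExtend (G.len_nonneg e) (fun x => u (G.pt e x))

/-! ### Trees and leaves -/

/-- The unordered pair of vertices joined by an edge. -/
def edgeEnds (e : E) : Sym2 V := s(G.vert (e, false), G.vert (e, true))

/-- `G` is a tree: it is connected and has no cycles. Loops are cycles with one edge, parallel
edges are cycles with two edges; when there are none of these, `G` has the same connectedness and
the same cycles as the simple graph of its adjacencies. -/
structure IsTree : Prop where
  loopless : ∀ e, G.vert (e, false) ≠ G.vert (e, true)
  no_parallel : Function.Injective G.edgeEnds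
  isTree : (SimpleGraph.fromEdgeSet (Set.range G.edgeEnds)).IsTree

/-- The degree of a vertex: the number of ends of edges in it. -/
def degree [Fintype E] [DecidableEq V] (v : V) : ℕ :=
  (Finset.univ.filter (fun a : E × Bool => G.vert a = v)).card

def IsLeaf [Fintype E] [DecidableEq V] (v : V) : Prop := G.degree v = 1

/-! ### The Schrödinger operator with standard (continuity and Kirchhoff) vertex conditions -/

/-- `f` belongs to `W^{1,2}(0, l)`, with weak derivative `g`; here `f` stands for its continuous
representative on `[0, l]`. -/
def HasSobolevDeriv (l : ℝ) (f g : ℝ → ℝ) : Prop :=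
  MemLp g 2 (volume.restrict (Set.Icc 0 l)) ∧
    ∀ x ∈ Set.Icc 0 l, f x = f 0 + ∫ y in (0 : ℝ)..x, g y

/-- The normal derivative, pointing into the vertex, at the end `a` of an edge, for a function on
`G` with edgewise derivatives `d`. -/
def normalDeriv (d : E → ℝ → ℝ) (a : E × Bool) : ℝ :=
  match a with
  | (e, false) => -d e 0
  | (e, true) => d e (G.len e)

/-- `u` is in the domain of the Schrödinger operator `H = -d²/dx² + q` on `G` and `H u = f`:
`u` is continuous on `G`, it is in `W^{2,2}` on each edge, with first and second derivatives `d e`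
and `dd e`, at each vertex the normal derivatives sum up to zero, and `-u'' + q u = f` almost
everywhere. -/
def SchrodingerEq [Fintype E] [DecidableEq V] (q u f : G.Point → ℝ) : Prop :=
  Continuous u ∧ ∃ d dd : E → ℝ → ℝ,
    (∀ e, HasSobolevDeriv (G.len e) (G.onEdge u e) (d e)) ∧
    (∀ e, HasSobolevDeriv (G.len e) (d e) (dd e)) ∧
    (∀ v, ∑ a : E × Bool with G.vert a = v, G.normalDeriv d a = 0) ∧
    (∀ e, ∀ᵐ x ∂volume.restrict (Set.Icc 0 (G.len e)),
      -dd e x + G.onEdge q e x * G.onEdge u e x = G.onEdge f e x)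

lemma onEdge_add (u v : G.Point → ℝ) (e : E) (x : ℝ) :
    G.onEdge (u + v) e x = G.onEdge u e x + G.onEdge v e x := rfl

lemma onEdge_smul (c : ℝ) (u : G.Point → ℝ) (e : E) (x : ℝ) :
    G.onEdge (c • u) e x = c * G.onEdge u e x := rfl

lemma HasSobolevDeriv.intervalIntegrable {l : ℝ} {f g : ℝ → ℝ} (h : HasSobolevDeriv l f g)
    {x : ℝ} (hx : x ∈ Set.Icc 0 l) : IntervalIntegrable g volume 0 x := by
  have h1 : IntegrableOn g (Set.Icc 0 l) volume := h.1.integrable (by norm_num)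
  rw [intervalIntegrable_iff_integrableOn_Icc_of_le hx.1]
  exact h1.mono_set (Set.Icc_subset_Icc_right hx.2)

lemma HasSobolevDeriv.add {l : ℝ} {f g f' g' : ℝ → ℝ} (h : HasSobolevDeriv l f g)
    (h' : HasSobolevDeriv l f' g') :
    HasSobolevDeriv l (fun x => f x + f' x) (fun x => g x + g' x) := by
  refine ⟨h.1.add h'.1, fun x hx => ?_⟩
  beta_reduce
  rw [intervalIntegral.integral_add (h.intervalIntegrable hx) (h'.intervalIntegrable hx),
    h.2 x hx, h'.2 x hx]
  ring

lemma HasSobolevDeriv.const_mul {l : ℝ} {f g : ℝ → ℝ} (c : ℝ) (h : HasSobolevDeriv l f g) :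
    HasSobolevDeriv l (fun x => c * f x) (fun x => c * g x) := by
  refine ⟨h.1.const_mul c, fun x hx => ?_⟩
  beta_reduce
  rw [intervalIntegral.integral_const_mul, h.2 x hx]
  ring

/-- The eigenspace `{u ∈ dom H : H u = mu u}`; it is zero unless `mu` is an eigenvalue. -/
def eigenspace [Fintype E] [DecidableEq V] (q : G.Point → ℝ) (mu : ℝ) :
    Submodule ℝ (G.Point → ℝ) where
  carrier := {u | G.SchrodingerEq q u (mu • u)}
  zero_mem' := by
    refine ⟨continuous_const, fun _ _ => 0, fun _ _ => 0, fun e => ⟨?_, ?_⟩, fun e => ⟨?_, ?_⟩,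
      fun v => ?_, fun e => ?_⟩
    · exact MemLp.zero
    · intro x _; simp [onEdge, Set.IccExtend]
    · exact MemLp.zero
    · intro x _; simp
    · refine Finset.sum_eq_zero ?_
      rintro ⟨e, b⟩ _
      cases b <;> simp [normalDeriv]
    · exact Filter.Eventually.of_forall fun x => by simp [onEdge, Set.IccExtend]
  add_mem' := by
    rintro u u' ⟨hc, d, dd, h1, h2, h3, h4⟩ ⟨hc', d', dd', h1', h2', h3', h4'⟩
    refine ⟨hc.add hc', fun e x => d e x + d' e x, fun e x => dd e x + dd' e x,
      fun e => (h1 e).add (h1' e), fun e => (h2 e).add (h2' e), fun v => ?_, fun e => ?_⟩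
    · have h := congrArg₂ (· + ·) (h3 v) (h3' v)
      simp only [add_zero] at h
      rw [← h, ← Finset.sum_add_distrib]
      refine Finset.sum_congr rfl ?_
      rintro ⟨e, b⟩ _
      cases b <;> simp [normalDeriv]
      ring
    · filter_upwards [h4 e, h4' e] with x hx hx'
      simp only [onEdge_add, onEdge_smul] at hx hx' ⊢
      linarith
  smul_mem' := by
    rintro c u ⟨hc, d, dd, h1, h2, h3, h4⟩
    refine ⟨hc.const_smul c, fun e x => c * d e x, fun e x => c * dd e x,
      fun e => (h1 e).const_mul c, fun e => (h2 e).const_mul c, fun v => ?_, fun e => ?_⟩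
    · rw [← mul_zero c, ← h3 v, Finset.mul_sum]
      refine Finset.sum_congr rfl ?_
      rintro ⟨e, b⟩ _
      cases b <;> simp [normalDeriv]
    · filter_upwards [h4 e] with x hx
      simp only [onEdge_smul] at hx ⊢
      linear_combination c * hx

/-- The multiplicity of `mu` as an eigenvalue: the dimension of its eigenspace. -/
def multiplicity [Fintype E] [DecidableEq V] (q : G.Point → ℝ) (mu : ℝ) : Cardinal :=
  Module.rank ℝ (G.eigenspace q mu)

/-- The eigenvalues `λ₁ ≤ λ₂ ≤ …` of `H` in increasing order, repeated according to multiplicity: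
`λ_n` (`n ≥ 1`) is the smallest real number such that the eigenfunctions with eigenvalue at most
that number span a space of dimension at least `n`. -/
def eigenvalue [Fintype E] [DecidableEq V] (q : G.Point → ℝ) (n : ℕ) : ℝ :=
  sInf {r : ℝ | (n : Cardinal) ≤
    Module.rank ℝ (⨆ mu : Set.Iic r, G.eigenspace q mu : Submodule ℝ (G.Point → ℝ))}

/-- The fundamental gap `Γ[q] = λ₂(G, q) - λ₁(G, q)`. -/
def fundamentalGap [Fintype E] [DecidableEq V] (q : G.Point → ℝ) : ℝ :=
  G.eigenvalue q 2 - G.eigenvalue q 1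

/-! ### Paths and convex potentials -/

/-- A (non-closed) path in `G`, given by its parametrization by arc length `toFun` on
`[0, length]`, which identifies the path with an interval. Parametrization by arc length means:
on each time interval `[s, t]` during which the path stays in one edge `e`, with (continuous)
coordinate `x`, the distance travelled is `t - s`. -/
structure ArcPath where
  length : ℝ
  toFun : ℝ → G.Point
  length_pos : 0 < length
  continuousOn : ContinuousOn toFun (Set.Icc 0 length)
  injOn : Set.InjOn toFun (Set.Icc 0 length)
  unit_speed : ∀ s t : ℝ, 0 ≤ s → s ≤ t → t ≤ length →
    ∀ (e : E) (x : ℝ → Set.Icc (0 : ℝ) (G.len e)), ContinuousOn x (Set.Icc s t) →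
      (∀ r ∈ Set.Icc s t, toFun r = G.pt e (x r)) → |(x t : ℝ) - (x s : ℝ)| = t - s

/-- The paths from one leaf to another leaf. -/
def leafPaths [Fintype E] [DecidableEq V] : Set G.ArcPath :=
  {P | ∃ a b : E × Bool, G.IsLeaf (G.vert a) ∧ G.IsLeaf (G.vert b) ∧ G.vert a ≠ G.vert b ∧
    P.toFun 0 = G.endPt a ∧ P.toFun P.length = G.endPt b}

/-- The class of functions that are convex on each of the given paths, regarded as an interval,
and take their values in `[0, M]` on the union of these paths. -/
def pathwiseConvexClass (Ps : Set G.ArcPath) (M : ℝ) : Set (G.Point → ℝ) :=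
  {q | (∀ P ∈ Ps, ConvexOn ℝ (Set.Icc 0 P.length) (fun s => q (P.toFun s))) ∧
    ∀ P ∈ Ps, ∀ s ∈ Set.Icc 0 P.length, 0 ≤ q (P.toFun s) ∧ q (P.toFun s) ≤ M}

/-- The class `C_{G,M}` of convex potentials on a tree, bounded by `M`. -/
def convexClass [Fintype E] [DecidableEq V] (M : ℝ) : Set (G.Point → ℝ) :=
  G.pathwiseConvexClass G.leafPaths M

end MetricGraph

end

/-!
Since the multiplicity of `λ₂(G, 0)` is at least two, it has an eigenfunction `u ≠ 0` that vanishes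
at a given leaf. By Kirchhoff's condition the derivative of `u` at the leaf vanishes too, so `u = 0`
on the edge of the leaf, and `u` stays an eigenfunction for every potential supported on this edge.
If such a potential `q` has a positive eigenfunction with eigenvalue `λ > 0`, then Picone's identity
gives `λ₁(G, q) = λ > 0 = λ₁(G, 0)`, and `u` shows that `λ₂(G, q) ≤ λ₂(G, 0)`.

To find `q`, start from the eigenvalue `λ = k²` and the eigenfunction instead. On the other edges
take the solution of `-f'' = k² f` that is `1` at the foot of the leaf edge and satisfies
Kirchhoff's conditions at the vertices not on the leaf edge; for small `k` it is close to the
constant `1`. On the leaf edge prescribe the logarithmic derivative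
`σ(s) = -a - (λ + a²) s + c s³`, where `s` is the distance to the foot, `a` is determined by
Kirchhoff's condition at the foot and `c` by Kirchhoff's condition at the leaf. Then
`q = λ + σ' + σ²` vanishes at the foot, and it is small, convex and increasing when `k` is small.
-/

noncomputable section

lemma exists_ne_zero_apply_eq_zero_of_one_lt_rank {K W : Type*} [DivisionRing K] [AddCommGroup W]
    [Module K W] (h : 1 < Module.rank K W) (T : W →ₗ[K] K) : ∃ w ≠ 0, T w = 0 := by
  by_contra! hT
  have hinj : Function.Injective T :=
    (injective_iff_map_eq_zero T).2 fun w hw => by_contra fun h0 => hT w h0 hw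
  have hrank := LinearMap.lift_rank_le_of_injective T hinj
  rw [Module.rank_self, Cardinal.lift_one, Cardinal.lift_le_one_iff] at hrank
  exact hrank.not_gt h

lemma linearIndependent_pair_of_apply_eq_zero {X K : Type*} [DivisionRing K] {f g : X → K} {x : X}
    (hf : f x ≠ 0) (hg : g ≠ 0) (hgx : g x = 0) : LinearIndependent K ![f, g] := by
  refine LinearIndependent.pair_iff.2 fun s t hst => ?_
  have hs : s = 0 := by simpa [hgx, hf] using congrFun hst x
  exact ⟨hs, by simpa [hs, hg] using hst⟩

open scoped Matrix Topology in
lemma exists_continuousAt_mulVec_eq {n X K : Type*} [Fintype n] [DecidableEq n]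
    [TopologicalSpace X] [Field K] [TopologicalSpace K] [IsTopologicalRing K] [ContinuousInv₀ K]
    [T1Space K] {A : X → Matrix n n K} {t₀ : X} (hA : ContinuousAt A t₀) (hdet : (A t₀).det ≠ 0)
    {x₀ r : n → K} (h₀ : A t₀ *ᵥ x₀ = r) :
    ∃ x : X → n → K, ContinuousAt x t₀ ∧ x t₀ = x₀ ∧ ∀ᶠ t in 𝓝 t₀, A t *ᵥ x t = r := by
  have hdetA : ContinuousAt (fun t => (A t).det) t₀ :=
    (Continuous.matrix_det continuous_id).continuousAt.comp hA
  have hadj : ContinuousAt (fun t => (A t).adjugate) t₀ :=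
    (Continuous.matrix_adjugate continuous_id).continuousAt.comp hA
  refine ⟨fun t => (A t).det⁻¹ • (A t).adjugate *ᵥ r, ?_, ?_, ?_⟩
  · exact (hdetA.inv₀ hdet).smul
      ((continuous_id.matrix_mulVec continuous_const).continuousAt.comp hadj)
  · beta_reduce
    rw [← h₀, Matrix.mulVec_mulVec, Matrix.adjugate_mul, Matrix.smul_mulVec, Matrix.one_mulVec,
      inv_smul_smul₀ hdet]
  · filter_upwards [hdetA.eventually_ne hdet] with t ht
    rw [Matrix.mulVec_smul, Matrix.mulVec_mulVec, Matrix.mul_adjugate, Matrix.smul_mulVec,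
      Matrix.one_mulVec, inv_smul_smul₀ ht]

lemma eqOn_zero_of_norm_deriv_le_mul_norm {F : Type*} [NormedAddCommGroup F] [NormedSpace ℝ F]
    {a b x₀ K : ℝ} {y y' : ℝ → F}
    (hy : ∀ x ∈ Set.Icc a b, HasDerivWithinAt y (y' x) (Set.Icc a b) x)
    (hbound : ∀ x ∈ Set.Icc a b, ‖y' x‖ ≤ K * ‖y x‖) (hx₀ : x₀ ∈ Set.Icc a b) (hy₀ : y x₀ = 0) :
    Set.EqOn y 0 (Set.Icc a b) := by
  have hcont : ContinuousOn y (Set.Icc a b) := fun x hx => (hy x hx).continuousWithinAt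
  intro x hx
  rcases le_total x₀ x with h | h
  · have hsub : Set.Icc x₀ b ⊆ Set.Icc a b := Set.Icc_subset_Icc_left hx₀.1
    exact eq_zero_of_abs_deriv_le_mul_abs_self_of_eq_zero_right (hcont.mono hsub)
      (fun t ht => (hy t (hsub (Set.Ico_subset_Icc_self ht))).mono_of_mem_nhdsWithin
        (Filter.mem_of_superset (Icc_mem_nhdsGE ht.2) (Set.Icc_subset_Icc_left (hx₀.1.trans ht.1))))
      hy₀ (fun t ht => hbound t (hsub (Set.Ico_subset_Icc_self ht))) x ⟨h, hx.2⟩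
  · have hneg : Set.MapsTo Neg.neg (Set.Icc (-x₀) (-a)) (Set.Icc a b) := fun t ht =>
      ⟨le_neg.1 ht.2, (neg_le.1 ht.1).trans hx₀.2⟩
    have hrefl := eq_zero_of_abs_deriv_le_mul_abs_self_of_eq_zero_right (f := y ∘ Neg.neg)
      (f' := fun t => (-1 : ℝ) • y' (-t)) (K := K) (hcont.comp continuousOn_neg hneg)
      (fun t ht => ((hy (-t) (hneg (Set.Ico_subset_Icc_self ht))).scomp t
        ((hasDerivAt_neg t).hasDerivWithinAt) hneg).mono_of_mem_nhdsWithin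
          (Filter.mem_of_superset (Icc_mem_nhdsGE ht.2) (Set.Icc_subset_Icc_left ht.1)))
      (by simpa using hy₀)
      (fun t ht => by simpa using hbound (-t) (hneg (Set.Ico_subset_Icc_self ht)))
    simpa using hrefl (-x) ⟨neg_le_neg h, neg_le_neg hx.1⟩

lemma eqOn_zero_of_hasDerivWithinAt_mul {a b x₀ : ℝ} {f d c : ℝ → ℝ}
    (hc : ContinuousOn c (Set.Icc a b))
    (hf : ∀ x ∈ Set.Icc a b, HasDerivWithinAt f (d x) (Set.Icc a b) x)
    (hd : ∀ x ∈ Set.Icc a b, HasDerivWithinAt d (c x * f x) (Set.Icc a b) x)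
    (hx₀ : x₀ ∈ Set.Icc a b) (hf₀ : f x₀ = 0) (hd₀ : d x₀ = 0) :
    Set.EqOn f 0 (Set.Icc a b) := by
  obtain ⟨C, hC⟩ := isCompact_Icc.exists_bound_of_continuousOn hc
  have hbound : ∀ x ∈ Set.Icc a b, ‖(d x, c x * f x)‖ ≤ max 1 C * ‖(f x, d x)‖ := by
    intro x hx
    refine max_le ?_ ?_
    · exact (norm_snd_le (f x, d x)).trans
        (le_mul_of_one_le_left (norm_nonneg _) (le_max_left 1 C))
    · rw [norm_mul]
      exact mul_le_mul ((hC x hx).trans (le_max_right 1 C)) (norm_fst_le (f x, d x))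
        (norm_nonneg _) (zero_le_one.trans (le_max_left 1 C))
  have hpair := eqOn_zero_of_norm_deriv_le_mul_norm (fun x hx => (hf x hx).prodMk (hd x hx))
    hbound hx₀ (Prod.ext hf₀ hd₀)
  exact fun x hx => congrArg Prod.fst (hpair hx)

lemma hasDerivWithinAt_picone {f d g dg : ℝ → ℝ} {p r x : ℝ} {s : Set ℝ}
    (hf : HasDerivWithinAt f (d x) s x) (hd : HasDerivWithinAt d (p * f x) s x)
    (hg : HasDerivWithinAt g (dg x) s x) (hdg : HasDerivWithinAt dg (r * g x) s x)
    (hgx : g x ≠ 0) :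
    HasDerivWithinAt (fun y => f y * d y - f y ^ 2 / g y * dg y)
      ((d x - f x * dg x / g x) ^ 2 + (p - r) * f x ^ 2) s x := by
  refine ((hf.fun_mul hd).fun_sub (((hf.fun_pow 2).fun_div hg hgx).fun_mul hdg)).congr_deriv ?_
  field_simp
  ring

lemma derivWithin_eq_zero_of_monotoneOn_of_eq {a b : ℝ} {D D' : ℝ → ℝ} (hab : a < b)
    (hD : ∀ x ∈ Set.Icc a b, HasDerivWithinAt D (D' x) (Set.Icc a b) x)
    (hmono : MonotoneOn D (Set.Icc a b)) (heq : D a = D b) {x : ℝ} (hx : x ∈ Set.Icc a b) :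
    D' x = 0 := by
  have ha : a ∈ Set.Icc a b := Set.left_mem_Icc.2 hab.le
  have hb : b ∈ Set.Icc a b := Set.right_mem_Icc.2 hab.le
  have hconst : ∀ y ∈ Set.Icc a b, D y = D a := fun y hy =>
    ((hmono hy hb hy.2).trans_eq heq.symm).antisymm (hmono ha hy hy.1)
  exact (uniqueDiffOn_Icc hab x hx).eq_deriv _ (hD x hx)
    ((hasDerivWithinAt_const x _ (D a)).congr hconst (hconst x hx))

namespace MetricGraph

variable {V E : Type*} (G : MetricGraph V E)

/-! ### Points, ends and functions on a metric graph -/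

/-- The other end of the edge of the end `a`. -/
def otherEnd (a : E × Bool) : E × Bool := (a.1, !a.2)

/-- The distance, along the edge of the end `a`, between `a` and the point with coordinate `x`. The
map is an involution, so it also computes the coordinate of a point from its distance to `a`. -/
def coordFrom (a : E × Bool) (x : ℝ) : ℝ := if a.2 then G.len a.1 - x else x

/-- The derivative of `coordFrom a`: `1` or `-1` according to whether the coordinate of the edge
increases or decreases away from the end `a`. -/
def orientation (a : E × Bool) : ℝ := if a.2 then -1 else 1

/-- The coordinate of the end `a` on its edge. -/
def endCoord (a : E × Bool) : ℝ := if a.2 then G.len a.1 else 0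

@[simp]
lemma otherEnd_fst (a : E × Bool) : (otherEnd a).1 = a.1 := rfl

lemma eq_or_eq_otherEnd {a b : E × Bool} (h : a.1 = b.1) : a = b ∨ a = otherEnd b := by
  rcases a with ⟨e, s⟩
  rcases b with ⟨e', t⟩
  obtain rfl : e = e' := h
  cases s <;> cases t <;> simp [otherEnd]

lemma coordFrom_coordFrom (a : E × Bool) (x : ℝ) : G.coordFrom a (G.coordFrom a x) = x := by
  unfold coordFrom
  split_ifs <;> ring

@[simp]
lemma coordFrom_endCoord (a : E × Bool) : G.coordFrom a (G.endCoord a) = 0 := by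
  unfold coordFrom endCoord
  split_ifs <;> simp

@[simp]
lemma coordFrom_otherEnd_endCoord (a : E × Bool) :
    G.coordFrom (otherEnd a) (G.endCoord a) = G.len a.1 := by
  rcases a with ⟨e, _ | _⟩ <;> simp [coordFrom, endCoord, otherEnd]

lemma abs_coordFrom_sub_coordFrom (a : E × Bool) (x y : ℝ) :
    |G.coordFrom a x - G.coordFrom a y| = |x - y| := by
  unfold coordFrom
  split_ifs
  · rw [sub_sub_sub_cancel_left, abs_sub_comm]
  · rfl

lemma coordFrom_mem (a : E × Bool) {x : ℝ} (hx : x ∈ Set.Icc 0 (G.len a.1)) :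
    G.coordFrom a x ∈ Set.Icc 0 (G.len a.1) := by
  unfold coordFrom
  split_ifs
  · exact ⟨sub_nonneg.2 hx.2, sub_le_self _ hx.1⟩
  · exact hx

lemma hasDerivAt_coordFrom (a : E × Bool) (x : ℝ) :
    HasDerivAt (G.coordFrom a) (orientation a) x := by
  rcases a with ⟨e, _ | _⟩
  · exact hasDerivAt_id x
  · exact (hasDerivAt_id x).const_sub (G.len e)

lemma continuous_coordFrom (a : E × Bool) : Continuous (G.coordFrom a) :=
  continuous_iff_continuousAt.2 fun x => (G.hasDerivAt_coordFrom a x).continuousAt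

lemma orientation_mul_self (a : E × Bool) : orientation a * orientation a = 1 := by
  rcases a with ⟨e, _ | _⟩ <;> simp [orientation]

lemma normalDeriv_eq (d : E → ℝ → ℝ) (a : E × Bool) :
    G.normalDeriv d a = -(orientation a * d a.1 (G.endCoord a)) := by
  rcases a with ⟨e, _ | _⟩ <;> simp [normalDeriv, orientation, endCoord]

lemma endCoord_mem (a : E × Bool) : G.endCoord a ∈ Set.Icc 0 (G.len a.1) := by
  rcases a with ⟨e, _ | _⟩ <;> simp [endCoord, G.len_nonneg]

lemma preEnd_eq (a : E × Bool) : G.preEnd a = ⟨a.1, ⟨G.endCoord a, G.endCoord_mem a⟩⟩ := by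
  rcases a with ⟨e, _ | _⟩ <;> rfl

lemma endPt_eq_pt (a : E × Bool) : G.endPt a = G.pt a.1 ⟨G.endCoord a, G.endCoord_mem a⟩ := by
  rw [endPt, preEnd_eq, pt]

lemma endPt_congr {a b : E × Bool} (h : G.vert a = G.vert b) : G.endPt a = G.endPt b :=
  Quotient.sound (Or.inr ⟨a, b, rfl, rfl, h⟩)

lemma exists_eq_pt (p : G.Point) : ∃ e x, p = G.pt e x := by
  induction p using Quotient.inductionOn with
  | h p => exact ⟨p.1, p.2, rfl⟩

lemma continuous_pt (e : E) : Continuous (G.pt e) :=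
  continuous_quotient_mk'.comp continuous_sigmaMk

lemma onEdge_of_mem (u : G.Point → ℝ) (e : E) {x : ℝ} (hx : x ∈ Set.Icc 0 (G.len e)) :
    G.onEdge u e x = u (G.pt e ⟨x, hx⟩) :=
  Set.IccExtend_of_mem _ _ hx

lemma onEdge_endCoord (u : G.Point → ℝ) (a : E × Bool) :
    G.onEdge u a.1 (G.endCoord a) = u (G.endPt a) := by
  rw [onEdge_of_mem _ _ _ (G.endCoord_mem a), endPt_eq_pt]

lemma continuous_onEdge {u : G.Point → ℝ} (hu : Continuous u) (e : E) :
    Continuous (G.onEdge u e) :=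
  (hu.comp (G.continuous_pt e)).Icc_extend'

/-- The function on `G` whose restriction to each edge `e` is the restriction of `f e` to
`[0, len e]`, provided that the family `f` has common values `X` at the vertices. -/
def glue (f : E → ℝ → ℝ) {X : V → ℝ} (hX : ∀ a : E × Bool, f a.1 (G.endCoord a) = X (G.vert a)) :
    G.Point → ℝ :=
  Quotient.lift (fun p : G.PrePoint => f p.1 p.2) (by
    rintro p p' (rfl | ⟨a, b, rfl, rfl, hab⟩)
    · rfl
    · rw [preEnd_eq, preEnd_eq]
      exact (hX a).trans ((congrArg X hab).trans (hX b).symm))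

section Glue

variable {f : E → ℝ → ℝ} {X : V → ℝ} (hX : ∀ a : E × Bool, f a.1 (G.endCoord a) = X (G.vert a))

lemma glue_pt (e : E) (x : Set.Icc (0 : ℝ) (G.len e)) : G.glue f hX (G.pt e x) = f e x := rfl

lemma glue_endPt (a : E × Bool) : G.glue f hX (G.endPt a) = X (G.vert a) := by
  rw [endPt_eq_pt, glue_pt, hX]

lemma onEdge_glue (e : E) : Set.EqOn (G.onEdge (G.glue f hX) e) (f e) (Set.Icc 0 (G.len e)) :=
  fun _ hx => G.onEdge_of_mem _ _ hx

lemma continuous_glue (hf : ∀ e, ContinuousOn (f e) (Set.Icc 0 (G.len e))) :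
    Continuous (G.glue f hX) :=
  Continuous.quotient_lift (continuous_sigma fun e => (hf e).domRestrict) _

end Glue

lemma finite_vertices (G : MetricGraph V E) [Finite E] : Finite V :=
  Finite.of_surjective _ G.vert_surjective

/-! ### Sums over the ends of the edges -/

section Sums

variable [Fintype E]

lemma sum_ends_eq (w : E × Bool → ℝ) : ∑ a, w a = ∑ e, (w (e, false) + w (e, true)) := by
  simp only [Fintype.sum_prod_type, Fintype.sum_bool, add_comm]

variable [DecidableEq V]

lemma sum_vert_mul [Fintype V] (x : V → ℝ) (w : E × Bool → ℝ) :
    ∑ a, x (G.vert a) * w a = ∑ v, x v * ∑ a with G.vert a = v, w a := by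
  rw [← Finset.sum_fiberwise Finset.univ G.vert]
  refine Finset.sum_congr rfl fun v _ => ?_
  rw [Finset.mul_sum]
  exact Finset.sum_congr rfl fun a ha => by rw [(Finset.mem_filter.1 ha).2]

variable {G}

lemma sum_endPt_mul_eq_zero {w : E × Bool → ℝ}
    (hw : ∀ v, ∑ a : E × Bool with G.vert a = v, w a = 0) (y : G.Point → ℝ) :
    ∑ a, y (G.endPt a) * w a = 0 := by
  have := G.finite_vertices
  have := Fintype.ofFinite V
  let x : V → ℝ := fun v => y (G.endPt (Function.surjInv G.vert_surjective v))
  have hx : ∀ a, y (G.endPt a) = x (G.vert a) := fun a =>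
    congrArg y (G.endPt_congr (Function.surjInv_eq G.vert_surjective _).symm)
  simp only [hx, sum_vert_mul, hw, mul_zero, Finset.sum_const_zero]

lemma sum_fiber_eq_zero_of_forall_ne {w : E × Bool → ℝ} {v₀ : V} (htotal : ∑ a, w a = 0)
    (hw : ∀ v ≠ v₀, ∑ a : E × Bool with G.vert a = v, w a = 0) (v : V) :
    ∑ a : E × Bool with G.vert a = v, w a = 0 := by
  have := G.finite_vertices
  have := Fintype.ofFinite V
  rcases eq_or_ne v v₀ with rfl | hv
  · rwa [← Finset.sum_fiberwise Finset.univ G.vert,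
      Finset.sum_eq_single v (fun v' _ => hw v') (by simp)] at htotal
  · exact hw v hv

variable {a b : E × Bool}

lemma IsLeaf.filter_vert_eq (hb : G.IsLeaf (G.vert b)) :
    Finset.univ.filter (fun a => G.vert a = G.vert b) = {b} := by
  obtain ⟨c, hc⟩ := Finset.card_eq_one.1 hb
  have hbc : b ∈ ({c} : Finset (E × Bool)) := hc ▸ Finset.mem_filter.2 ⟨Finset.mem_univ b, rfl⟩
  rw [hc, Finset.mem_singleton.1 hbc]

lemma IsLeaf.eq_of_vert_eq (hb : G.IsLeaf (G.vert b)) (h : G.vert a = G.vert b) : a = b := by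
  rw [← Finset.mem_singleton, ← hb.filter_vert_eq]
  exact Finset.mem_filter.2 ⟨Finset.mem_univ a, h⟩

lemma IsLeaf.vert_otherEnd_ne (hb : G.IsLeaf (G.vert b)) : G.vert (otherEnd b) ≠ G.vert b :=
  fun h => by simpa [otherEnd] using congrArg Prod.snd (hb.eq_of_vert_eq h)

lemma IsLeaf.vert_ne (hb : G.IsLeaf (G.vert b)) (ha : a.1 ≠ b.1) : G.vert a ≠ G.vert b :=
  fun h => ha (congrArg Prod.fst (hb.eq_of_vert_eq h))

end Sums

/-! ### Classical solutions -/

lemma hasSobolevDeriv_of_hasDerivWithinAt {l : ℝ} {f g : ℝ → ℝ}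
    (hf : ∀ x ∈ Set.Icc 0 l, HasDerivWithinAt f (g x) (Set.Icc 0 l) x)
    (hg : ContinuousOn g (Set.Icc 0 l)) : HasSobolevDeriv l f g := by
  obtain ⟨C, hC⟩ := isCompact_Icc.exists_bound_of_continuousOn hg
  refine ⟨MemLp.of_bound (hg.aestronglyMeasurable measurableSet_Icc) C
    (ae_restrict_of_forall_mem measurableSet_Icc hC), fun x hx => ?_⟩
  have hsub : Set.Icc 0 x ⊆ Set.Icc 0 l := Set.Icc_subset_Icc_right hx.2
  have hint : ∫ y in (0 : ℝ)..x, g y = f x - f 0 :=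
    intervalIntegral.integral_eq_sub_of_hasDerivAt_of_le hx.1
      (fun y hy => ((hf y (hsub hy)).continuousWithinAt).mono hsub)
      (fun y hy => (hf y (hsub ⟨hy.1.le, hy.2.le⟩)).hasDerivAt
        (Icc_mem_nhds hy.1 (hy.2.trans_le hx.2)))
      ((hg.mono hsub).intervalIntegrable_of_Icc hx.1)
  rw [hint, add_sub_cancel]

lemma HasSobolevDeriv.hasDerivWithinAt {l : ℝ} {f g g' : ℝ → ℝ} (h : HasSobolevDeriv l f g)
    (hg' : ContinuousOn g' (Set.Icc 0 l)) (hgg' : g =ᵐ[volume.restrict (Set.Icc 0 l)] g')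
    {x : ℝ} (hx : x ∈ Set.Icc 0 l) : HasDerivWithinAt f (g' x) (Set.Icc 0 l) x := by
  have hl : 0 ≤ l := hx.1.trans hx.2
  let G' := Set.IccExtend hl (Set.domRestrict (Set.Icc 0 l) g')
  have hG' : Continuous G' := hg'.domRestrict.Icc_extend'
  have hGg : Set.EqOn G' g' (Set.Icc 0 l) := fun y hy => Set.IccExtend_of_mem _ _ hy
  have hgG : g =ᵐ[volume.restrict (Set.Icc 0 l)] G' :=
    hgg'.trans (ae_restrict_of_forall_mem measurableSet_Icc fun y hy => (hGg hy).symm)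
  have hf : ∀ y ∈ Set.Icc 0 l, f y = f 0 + ∫ t in (0 : ℝ)..y, G' t := by
    intro y hy
    rw [h.2 y hy, intervalIntegral.integral_congr_ae_restrict]
    rw [Set.uIoc_of_le hy.1]
    exact ae_restrict_of_ae_restrict_of_subset
      (Set.Ioc_subset_Icc_self.trans (Set.Icc_subset_Icc_right hy.2)) hgG
  have hderiv : HasDerivAt (fun y => f 0 + ∫ t in (0 : ℝ)..y, G' t) (g' x) x :=
    hGg hx ▸ (hG'.integral_hasStrictDerivAt 0 x).hasDerivAt.const_add _
  exact hderiv.hasDerivWithinAt.congr hf (hf x hx)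

/-- `u` is a classical solution of `-u'' + q u = mu u` on `G` with standard vertex conditions, and
`d` is its edgewise derivative. For continuous `q` these are exactly the elements of the
eigenspace. -/
structure IsClassicalSolution [Fintype E] [DecidableEq V] (q : G.Point → ℝ) (mu : ℝ)
    (u : G.Point → ℝ) (d : E → ℝ → ℝ) : Prop where
  continuous : Continuous u
  hasDeriv : ∀ e, ∀ x ∈ Set.Icc 0 (G.len e),
    HasDerivWithinAt (G.onEdge u e) (d e x) (Set.Icc 0 (G.len e)) x
  hasDeriv_deriv : ∀ e, ∀ x ∈ Set.Icc 0 (G.len e),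
    HasDerivWithinAt (d e) ((G.onEdge q e x - mu) * G.onEdge u e x) (Set.Icc 0 (G.len e)) x
  kirchhoff : ∀ v, ∑ a : E × Bool with G.vert a = v, G.normalDeriv d a = 0

variable {G} [Fintype E] [DecidableEq V] {q u : G.Point → ℝ} {mu : ℝ}

lemma mem_eigenspace_iff_exists_isClassicalSolution (hq : Continuous q) :
    u ∈ G.eigenspace q mu ↔ ∃ d, G.IsClassicalSolution q mu u d := by
  have hcont : Continuous u → ∀ e, ContinuousOn
      (fun x => (G.onEdge q e x - mu) * G.onEdge u e x) (Set.Icc 0 (G.len e)) := fun hu e =>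
    (((G.continuous_onEdge hq e).sub continuous_const).mul (G.continuous_onEdge hu e)).continuousOn
  constructor
  · rintro ⟨hu, d, dd, hud, hdd, hk, heq⟩
    have hd : ∀ e, ∀ x ∈ Set.Icc 0 (G.len e), HasDerivWithinAt (d e)
        ((G.onEdge q e x - mu) * G.onEdge u e x) (Set.Icc 0 (G.len e)) x := by
      refine fun e x hx => (hdd e).hasDerivWithinAt (hcont hu e) ?_ hx
      filter_upwards [heq e] with y hy
      rw [onEdge_smul] at hy
      linear_combination -hy
    exact ⟨d, hu, fun e x hx => (hud e).hasDerivWithinAt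
      (fun y hy => (hd e y hy).continuousWithinAt) (ae_eq_refl _) hx, hd, hk⟩
  · rintro ⟨d, h⟩
    refine ⟨h.continuous, d, fun e x => (G.onEdge q e x - mu) * G.onEdge u e x, fun e => ?_,
      fun e => ?_, h.kirchhoff, fun e => Filter.Eventually.of_forall fun x => ?_⟩
    · exact hasSobolevDeriv_of_hasDerivWithinAt (h.hasDeriv e)
        fun x hx => (h.hasDeriv_deriv e x hx).continuousWithinAt
    · exact hasSobolevDeriv_of_hasDerivWithinAt (h.hasDeriv_deriv e) (hcont h.continuous e)
    · rw [onEdge_smul]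
      ring

lemma isClassicalSolution_glue {f d : E → ℝ → ℝ} {X : V → ℝ}
    (hX : ∀ a : E × Bool, f a.1 (G.endCoord a) = X (G.vert a))
    (hf : ∀ e, ∀ x ∈ Set.Icc 0 (G.len e), HasDerivWithinAt (f e) (d e x) (Set.Icc 0 (G.len e)) x)
    (hd : ∀ e, ∀ x ∈ Set.Icc 0 (G.len e),
      HasDerivWithinAt (d e) ((G.onEdge q e x - mu) * f e x) (Set.Icc 0 (G.len e)) x)
    (hk : ∀ v, ∑ a : E × Bool with G.vert a = v, G.normalDeriv d a = 0) :
    G.IsClassicalSolution q mu (G.glue f hX) d where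
  continuous := G.continuous_glue hX fun e x hx => (hf e x hx).continuousWithinAt
  hasDeriv e x hx := (hf e x hx).congr (G.onEdge_glue hX e) (G.onEdge_glue hX e hx)
  hasDeriv_deriv e x hx := by
    rw [G.onEdge_glue hX e hx]
    exact hd e x hx
  kirchhoff := hk

lemma IsClassicalSolution.eqOn_zero_of_endPt_eq_zero {d : E → ℝ → ℝ} {a : E × Bool}
    (hq : Continuous q) (h : G.IsClassicalSolution q mu u d) (hu : u (G.endPt a) = 0)
    (hd : G.normalDeriv d a = 0) : Set.EqOn (G.onEdge u a.1) 0 (Set.Icc 0 (G.len a.1)) := by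
  have hor : orientation a ≠ 0 := left_ne_zero_of_mul_eq_one (orientation_mul_self a)
  rw [normalDeriv_eq, neg_eq_zero, mul_eq_zero, or_iff_right hor] at hd
  exact eqOn_zero_of_hasDerivWithinAt_mul
    ((G.continuous_onEdge hq a.1).sub continuous_const).continuousOn (h.hasDeriv a.1)
    (h.hasDeriv_deriv a.1) (G.endCoord_mem a) ((G.onEdge_endCoord u a).trans hu) hd

lemma IsLeaf.eqOn_zero_of_mem_eigenspace {b : E × Bool} (hb : G.IsLeaf (G.vert b))
    (hq : Continuous q) (hu : u ∈ G.eigenspace q mu) (hub : u (G.endPt b) = 0) :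
    Set.EqOn (G.onEdge u b.1) 0 (Set.Icc 0 (G.len b.1)) := by
  obtain ⟨d, hd⟩ := (mem_eigenspace_iff_exists_isClassicalSolution hq).1 hu
  have hk := hd.kirchhoff (G.vert b)
  rw [hb.filter_vert_eq, Finset.sum_singleton] at hk
  exact hd.eqOn_zero_of_endPt_eq_zero hq hub hk

lemma mem_eigenspace_of_mul_eq {q' : G.Point → ℝ} (hqq' : ∀ p, q p * u p = q' p * u p)
    (hu : u ∈ G.eigenspace q' mu) : u ∈ G.eigenspace q mu := by
  obtain ⟨hc, d, dd, hud, hdd, hk, heq⟩ := hu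
  refine ⟨hc, d, dd, hud, hdd, hk, fun e => ?_⟩
  filter_upwards [heq e] with x hx
  exact (congrArg (-dd e x + ·) (hqq' _)).trans hx

/-! ### Positive eigenfunctions -/

variable {lam : ℝ} {phi : G.Point → ℝ}

lemma sum_normalDeriv_picone_eq_zero {p : G.Point → ℝ} {d dphi : E → ℝ → ℝ}
    (hu : G.IsClassicalSolution q mu u d) (hphi : G.IsClassicalSolution p lam phi dphi) :
    ∑ a, G.normalDeriv (fun e x => G.onEdge u e x * d e x
      - G.onEdge u e x ^ 2 / G.onEdge phi e x * dphi e x) a = 0 := by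
  have hsplit : ∀ a, G.normalDeriv (fun e x => G.onEdge u e x * d e x
      - G.onEdge u e x ^ 2 / G.onEdge phi e x * dphi e x) a =
      u (G.endPt a) * G.normalDeriv d a -
        u (G.endPt a) ^ 2 / phi (G.endPt a) * G.normalDeriv dphi a := by
    intro a
    simp only [normalDeriv_eq, onEdge_endCoord]
    ring
  rw [Finset.sum_congr rfl fun a _ => hsplit a, Finset.sum_sub_distrib,
    sum_endPt_mul_eq_zero hu.kirchhoff u,
    sum_endPt_mul_eq_zero hphi.kirchhoff (fun p => u p ^ 2 / phi p), sub_zero]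

lemma eigenvalue_le_of_pos (hq : Continuous q) (hphi : phi ∈ G.eigenspace q lam)
    (hpos : ∀ p, 0 < phi p) (hu : u ∈ G.eigenspace q mu) (hu0 : u ≠ 0) : lam ≤ mu := by
  by_contra! hlt
  obtain ⟨d, hd⟩ := (mem_eigenspace_iff_exists_isClassicalSolution hq).1 hu
  obtain ⟨dphi, hdphi⟩ := (mem_eigenspace_iff_exists_isClassicalSolution hq).1 hphi
  let D : E → ℝ → ℝ := fun e x =>
    G.onEdge u e x * d e x - G.onEdge u e x ^ 2 / G.onEdge phi e x * dphi e x
  let D' : E → ℝ → ℝ := fun e x =>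
    (d e x - G.onEdge u e x * dphi e x / G.onEdge phi e x) ^ 2 +
      (lam - mu) * G.onEdge u e x ^ 2
  have hD : ∀ e, ∀ x ∈ Set.Icc 0 (G.len e),
      HasDerivWithinAt (D e) (D' e x) (Set.Icc 0 (G.len e)) x := fun e x hx => by
    convert hasDerivWithinAt_picone (hd.hasDeriv e x hx) (hd.hasDeriv_deriv e x hx)
      (hdphi.hasDeriv e x hx) (hdphi.hasDeriv_deriv e x hx) (hpos _).ne' using 1
    ring
  have hmono : ∀ e, MonotoneOn (D e) (Set.Icc 0 (G.len e)) := fun e =>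
    monotoneOn_of_hasDerivWithinAt_nonneg (convex_Icc _ _)
      (fun x hx => (hD e x hx).continuousWithinAt)
      (fun x hx => (hD e x (interior_subset hx)).mono interior_subset)
      (fun x _ => add_nonneg (sq_nonneg _) (mul_nonneg (sub_nonneg.2 hlt.le) (sq_nonneg _)))
  have hincr : ∀ e ∈ Finset.univ, 0 ≤ -D e 0 + D e (G.len e) := fun e _ => by
    rw [neg_add_eq_sub, sub_nonneg]
    exact hmono e (Set.left_mem_Icc.2 (G.len_nonneg e)) (Set.right_mem_Icc.2 (G.len_nonneg e))
      (G.len_nonneg e)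
  have hsum : ∑ e, (-D e 0 + D e (G.len e)) = 0 :=
    (sum_ends_eq (G.normalDeriv D)).symm.trans (sum_normalDeriv_picone_eq_zero hd hdphi)
  have hends : ∀ e, D e 0 = D e (G.len e) := fun e =>
    neg_add_eq_zero.1 ((Finset.sum_eq_zero_iff_of_nonneg hincr).1 hsum e (Finset.mem_univ e))
  refine hu0 (funext fun p => ?_)
  obtain ⟨e, x, rfl⟩ := G.exists_eq_pt p
  have hzero := derivWithin_eq_zero_of_monotoneOn_of_eq (G.len_pos e) (hD e) (hmono e) (hends e) x.2
  have hsq := ((add_eq_zero_iff_of_nonneg (sq_nonneg _)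
    (mul_nonneg (sub_nonneg.2 hlt.le) (sq_nonneg _))).1 hzero).2
  simpa [(sub_pos.2 hlt).ne', G.onEdge_of_mem u e x.2] using hsq

lemma le_of_one_le_rank_iSup_eigenspace {r : ℝ} (hq : Continuous q)
    (hphi : phi ∈ G.eigenspace q lam) (hpos : ∀ p, 0 < phi p)
    (hr : 1 ≤ Module.rank ℝ (⨆ mu : Set.Iic r, G.eigenspace q mu : Submodule ℝ (G.Point → ℝ))) :
    lam ≤ r := by
  by_contra! hlt
  have hbot : (⨆ mu : Set.Iic r, G.eigenspace q mu : Submodule ℝ (G.Point → ℝ)) = ⊥ :=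
    iSup_eq_bot.2 fun mu => (Submodule.eq_bot_iff _).2 fun u hu => by_contra fun hu0 =>
      (mu.2.trans_lt hlt).not_ge (eigenvalue_le_of_pos hq hphi hpos hu hu0)
  rw [hbot, rank_bot] at hr
  exact zero_lt_one.not_ge hr

lemma linearIndependent_le_rank_iSup_eigenspace {n : ℕ} {r : ℝ} {v : Fin n → G.Point → ℝ}
    (hv : LinearIndependent ℝ v) (hmem : ∀ i, ∃ mu ≤ r, v i ∈ G.eigenspace q mu) :
    (n : Cardinal) ≤
      Module.rank ℝ (⨆ mu : Set.Iic r, G.eigenspace q mu : Submodule ℝ (G.Point → ℝ)) := by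
  set W := (⨆ mu : Set.Iic r, G.eigenspace q mu : Submodule ℝ (G.Point → ℝ))
  have hW : ∀ i, v i ∈ W := fun i =>
    let ⟨mu, hmu, hvi⟩ := hmem i
    Submodule.mem_iSup_of_mem (⟨mu, hmu⟩ : Set.Iic r) hvi
  have hli : LinearIndependent ℝ (fun i => (⟨v i, hW i⟩ : W)) :=
    LinearIndependent.of_comp W.subtype hv
  simpa using hli.cardinal_lift_le_rank

lemma eigenvalue_one_eq [Nonempty G.Point] (hq : Continuous q) (hphi : phi ∈ G.eigenspace q lam)
    (hpos : ∀ p, 0 < phi p) : G.eigenvalue q 1 = lam := by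
  have hphi0 : phi ≠ 0 := fun h => (hpos (Classical.arbitrary _)).ne' (congrFun h _)
  refine IsLeast.csInf_eq ⟨?_, fun r hr => ?_⟩
  · have hli : LinearIndependent ℝ (fun _ : Fin 1 => phi) := .of_subsingleton 0 hphi0
    exact linearIndependent_le_rank_iSup_eigenspace hli fun _ => ⟨lam, le_rfl, hphi⟩
  · exact le_of_one_le_rank_iSup_eigenspace hq hphi hpos (by simpa using hr)

lemma eigenvalue_two_le (hq : Continuous q) (hphi : phi ∈ G.eigenspace q lam)
    (hpos : ∀ p, 0 < phi p) (hu : u ∈ G.eigenspace q mu) (hli : LinearIndependent ℝ ![phi, u]) :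
    G.eigenvalue q 2 ≤ mu := by
  have hle : lam ≤ mu := eigenvalue_le_of_pos hq hphi hpos hu (hli.ne_zero 1)
  refine csInf_le ⟨lam, fun r hr => ?_⟩ ?_
  · exact le_of_one_le_rank_iSup_eigenspace hq hphi hpos
      ((Nat.one_le_cast.2 one_le_two).trans (Set.mem_ofPred.1 hr))
  · refine linearIndependent_le_rank_iSup_eigenspace hli fun i => ?_
    fin_cases i
    exacts [⟨lam, hle, hphi⟩, ⟨mu, le_rfl, hu⟩]

lemma one_mem_eigenspace : (1 : G.Point → ℝ) ∈ G.eigenspace 0 0 := by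
  refine (mem_eigenspace_iff_exists_isClassicalSolution continuous_zero).2
    ⟨fun _ _ => 0, continuous_one, fun e x _ => hasDerivWithinAt_const x _ (1 : ℝ), fun e x _ => ?_,
      fun v => Finset.sum_eq_zero fun a _ => by simp [normalDeriv_eq]⟩
  exact (hasDerivWithinAt_const x _ (0 : ℝ)).congr_deriv (by simp [onEdge, Set.IccExtend])

lemma exists_mem_eigenspace_apply_eq_zero (h : 2 ≤ G.multiplicity q mu) (p : G.Point) :
    ∃ u ∈ G.eigenspace q mu, u ≠ 0 ∧ u p = 0 := by
  obtain ⟨u, hu0, hup⟩ := exists_ne_zero_apply_eq_zero_of_one_lt_rank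
    (Cardinal.one_lt_two.trans_le h) ((LinearMap.proj p).comp (G.eigenspace q mu).subtype)
  exact ⟨u, u.2, Subtype.coe_ne_coe.2 hu0, hup⟩

lemma fundamentalGap_lt_of_pos {p : G.Point} (hq : Continuous q) (hlam : 0 < lam)
    (hphi : phi ∈ G.eigenspace q lam) (hpos : ∀ p, 0 < phi p)
    (hu : u ∈ G.eigenspace q (G.eigenvalue 0 2)) (hu0 : u ≠ 0) (hup : u p = 0) :
    G.fundamentalGap q < G.fundamentalGap 0 := by
  have : Nonempty G.Point := ⟨p⟩
  have hfirst : G.eigenvalue q 1 = lam := eigenvalue_one_eq hq hphi hpos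
  have hfirst_zero : G.eigenvalue 0 1 = 0 :=
    eigenvalue_one_eq continuous_zero one_mem_eigenspace fun _ => one_pos
  have hsecond : G.eigenvalue q 2 ≤ G.eigenvalue 0 2 := eigenvalue_two_le hq hphi hpos hu
    (linearIndependent_pair_of_apply_eq_zero (hpos p).ne' hu0 hup)
  simp only [fundamentalGap, hfirst, hfirst_zero]
  linarith

end MetricGraph

namespace MetricGraph

/-! ### Convexity along paths -/

/-- For `t ∈ [0, L]`, `g t` behaves like the distance to the foot of a spike of a point that
travels with unit speed along a path without self-intersections: where `g` is positive, the point is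
on the spike and the value of `g` determines its position. -/
structure IsUnitSpeedExcursion (g : ℝ → ℝ) (L : ℝ) : Prop where
  continuousOn : ContinuousOn g (Set.Icc 0 L)
  nonneg : ∀ t ∈ Set.Icc 0 L, 0 ≤ g t
  injOn : Set.InjOn g {t ∈ Set.Icc 0 L | 0 < g t}
  unit_speed : ∀ s t, 0 ≤ s → s ≤ t → t ≤ L → (∀ r ∈ Set.Icc s t, 0 < g r) → |g t - g s| = t - s

namespace IsUnitSpeedExcursion

variable {g : ℝ → ℝ} {L : ℝ}

lemma reverse (h : IsUnitSpeedExcursion g L) : IsUnitSpeedExcursion (fun t => g (L - t)) L := by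
  have hmaps : ∀ t ∈ Set.Icc 0 L, L - t ∈ Set.Icc 0 L := fun t ht =>
    ⟨sub_nonneg.2 ht.2, sub_le_self _ ht.1⟩
  refine ⟨h.continuousOn.comp (continuousOn_const.sub continuousOn_id) hmaps,
    fun t ht => h.nonneg _ (hmaps t ht), fun s hs t ht hst => ?_, fun s t hs hst ht hpos => ?_⟩
  · exact sub_right_injective (h.injOn ⟨hmaps s hs.1, hs.2⟩ ⟨hmaps t ht.1, ht.2⟩ hst)
  · have hpos' : ∀ r ∈ Set.Icc (L - t) (L - s), 0 < g r := fun r hr => by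
      simpa using hpos (L - r) ⟨by linarith [hr.2], by linarith [hr.1]⟩
    rw [abs_sub_comm, h.unit_speed (L - t) (L - s) (by linarith) (by linarith) (by linarith) hpos']
    ring

lemma monotoneOn (h : IsUnitSpeedExcursion g L) (h0 : g 0 = 0) : MonotoneOn g (Set.Icc 0 L) := by
  intro s hs t ht hst
  by_contra! hlt
  have hpos : 0 < (g t + g s) / 2 := by linarith [h.nonneg t ht]
  obtain ⟨r, hr, hgr⟩ : (g t + g s) / 2 ∈ g '' Set.Icc 0 s :=
    intermediate_value_Icc hs.1 (h.continuousOn.mono (Set.Icc_subset_Icc_right hs.2))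
      ⟨by linarith, by linarith⟩
  obtain ⟨r', hr', hgr'⟩ : (g t + g s) / 2 ∈ g '' Set.Icc s t :=
    intermediate_value_Icc' hst (h.continuousOn.mono (Set.Icc_subset_Icc hs.1 ht.2))
      ⟨by linarith, by linarith⟩
  have hrr' : r = r' := h.injOn ⟨⟨hr.1, hr.2.trans hs.2⟩, hgr ▸ hpos⟩
    ⟨⟨hs.1.trans hr'.1, hr'.2.trans ht.2⟩, hgr' ▸ hpos⟩ (hgr.trans hgr'.symm)
  obtain rfl : r = s := le_antisymm hr.2 (hrr' ▸ hr'.1)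
  linarith

lemma eq_of_pos (h : IsUnitSpeedExcursion g L) (h0 : g 0 = 0) {t : ℝ} (ht : t ∈ Set.Icc 0 L)
    (hgt : 0 < g t) : g t = g L - (L - t) := by
  have hmono := h.monotoneOn h0
  have hL : L ∈ Set.Icc 0 L := ⟨ht.1.trans ht.2, le_rfl⟩
  have hspeed := h.unit_speed t L ht.1 ht.2 le_rfl fun r hr =>
    hgt.trans_le (hmono ht ⟨ht.1.trans hr.1, hr.2⟩ hr.1)
  rw [abs_of_nonneg (sub_nonneg.2 (hmono ht hL ht.2))] at hspeed
  linarith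

lemma eq_max (h : IsUnitSpeedExcursion g L) (h0 : g 0 = 0) {t : ℝ} (ht : t ∈ Set.Icc 0 L) :
    g t = max (g L - (L - t)) 0 := by
  rcases (h.nonneg t ht).eq_or_lt with hgt | hgt
  · refine hgt ▸ (max_eq_right ?_).symm
    by_contra! hlt
    obtain ⟨r, hr, hgr⟩ : (g L - (L - t)) / 2 ∈ g '' Set.Icc t L :=
      intermediate_value_Icc ht.2 (h.continuousOn.mono (Set.Icc_subset_Icc_left ht.1))
        ⟨by linarith, by linarith [ht.2]⟩
    have := h.eq_of_pos h0 ⟨ht.1.trans hr.1, hr.2⟩ (by linarith)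
    linarith [hr.1]
  · rw [max_eq_left (h.eq_of_pos h0 ht hgt ▸ hgt.le), ← h.eq_of_pos h0 ht hgt]

lemma convexOn (h : IsUnitSpeedExcursion g L) (h0L : g 0 = 0 ∨ g L = 0) :
    ConvexOn ℝ (Set.Icc 0 L) g := by
  have hI : Convex ℝ (Set.Icc 0 L) := convex_Icc 0 L
  rcases h0L with h0 | hL
  · have hmax : ConvexOn ℝ (Set.Icc 0 L) fun t => max (g L - (L - t)) 0 :=
      ((convexOn_const (g L) hI).sub ((concaveOn_const L hI).sub (convexOn_id hI))).sup
        (convexOn_const 0 hI)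
    exact hmax.congr fun t ht => (h.eq_max h0 ht).symm
  · have hmax : ConvexOn ℝ (Set.Icc 0 L) fun t => max (g 0 - t) 0 :=
      ((convexOn_const (g 0) hI).sub (concaveOn_id hI)).sup (convexOn_const 0 hI)
    refine hmax.congr fun t ht => ?_
    have := h.reverse.eq_max (t := L - t) (by simpa using hL)
      ⟨sub_nonneg.2 ht.2, sub_le_self _ ht.1⟩
    simpa using this.symm

end IsUnitSpeedExcursion

variable {V E : Type*} {G : MetricGraph V E} [Fintype E] [DecidableEq E] [DecidableEq V]
  {b : E × Bool}

/-- The distance to the complement of the edge of the leaf `b`: on this edge it is the distance to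
the end other than `b`, and it vanishes on all other edges. -/
def leafHeight (hb : G.IsLeaf (G.vert b)) : G.Point → ℝ :=
  G.glue (Function.update 0 b.1 (G.coordFrom (otherEnd b)))
    (X := fun v => if v = G.vert b then G.len b.1 else 0) (by
      intro a
      by_cases ha : a.1 = b.1
      · rcases eq_or_eq_otherEnd ha with rfl | rfl
        · simp
        · rw [otherEnd_fst, Function.update_self, coordFrom_endCoord, if_neg hb.vert_otherEnd_ne]
      · simp [ha, hb.vert_ne ha])

variable (hb : G.IsLeaf (G.vert b))

lemma leafHeight_pt (x : Set.Icc (0 : ℝ) (G.len b.1)) :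
    leafHeight hb (G.pt b.1 x) = G.coordFrom (otherEnd b) x := by
  rw [leafHeight, glue_pt, Function.update_self]

lemma leafHeight_pt_of_ne {e : E} (he : e ≠ b.1) (x : Set.Icc (0 : ℝ) (G.len e)) :
    leafHeight hb (G.pt e x) = 0 := by
  rw [leafHeight, glue_pt, Function.update_of_ne he, Pi.zero_apply, Pi.zero_apply]

lemma leafHeight_endPt_of_ne {a : E × Bool} (ha : G.vert a ≠ G.vert b) :
    leafHeight hb (G.endPt a) = 0 := by
  rw [leafHeight, glue_endPt, if_neg ha]

lemma continuous_leafHeight : Continuous (leafHeight hb) := by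
  refine G.continuous_glue _ fun e => ?_
  rcases eq_or_ne e b.1 with rfl | he
  · rw [Function.update_self]
    exact (G.continuous_coordFrom _).continuousOn
  · rw [Function.update_of_ne he]
    exact continuousOn_const

lemma leafHeight_mem (p : G.Point) : leafHeight hb p ∈ Set.Icc 0 (G.len b.1) := by
  obtain ⟨e, x, rfl⟩ := G.exists_eq_pt p
  rcases eq_or_ne e b.1 with rfl | he
  · rw [leafHeight_pt]
    exact G.coordFrom_mem (otherEnd b) x.2
  · rw [leafHeight_pt_of_ne hb he]
    exact Set.left_mem_Icc.2 (G.len_nonneg _)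

lemma eq_pt_of_leafHeight_pos {p : G.Point} (hp : 0 < leafHeight hb p) :
    p = G.pt b.1 ⟨G.coordFrom (otherEnd b) (leafHeight hb p),
      G.coordFrom_mem (otherEnd b) (leafHeight_mem hb p)⟩ := by
  obtain ⟨e, x, rfl⟩ := G.exists_eq_pt p
  rcases eq_or_ne e b.1 with rfl | he
  · simp only [leafHeight_pt, coordFrom_coordFrom, Subtype.coe_eta]
  · exact absurd (leafHeight_pt_of_ne hb he x) hp.ne'

lemma isUnitSpeedExcursion_leafHeight (P : G.ArcPath) :
    IsUnitSpeedExcursion (fun t => leafHeight hb (P.toFun t)) P.length := by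
  have hcont : ContinuousOn (fun t => leafHeight hb (P.toFun t)) (Set.Icc 0 P.length) :=
    (continuous_leafHeight hb).comp_continuousOn P.continuousOn
  refine ⟨hcont, fun t _ => (leafHeight_mem hb _).1, fun s hs t ht hst => ?_,
    fun s t hs hst ht hpos => ?_⟩
  · refine P.injOn hs.1 ht.1 ?_
    rw [eq_pt_of_leafHeight_pos hb hs.2, eq_pt_of_leafHeight_pos hb ht.2]
    congr 3
  · rw [← G.abs_coordFrom_sub_coordFrom (otherEnd b)]
    refine P.unit_speed s t hs hst ht b.1 (fun r => ⟨G.coordFrom (otherEnd b)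
      (leafHeight hb (P.toFun r)), G.coordFrom_mem (otherEnd b) (leafHeight_mem hb _)⟩) ?_
      fun r hr => eq_pt_of_leafHeight_pos hb (hpos r hr)
    exact Topology.IsInducing.subtypeVal.continuousOn_iff.2
      ((G.continuous_coordFrom _).comp_continuousOn (hcont.mono (Set.Icc_subset_Icc hs ht)))

lemma comp_leafHeight_mem_convexClass {Q : ℝ → ℝ} {M : ℝ}
    (hconv : ConvexOn ℝ (Set.Icc 0 (G.len b.1)) Q) (hmono : MonotoneOn Q (Set.Icc 0 (G.len b.1)))
    (hQ : ∀ s ∈ Set.Icc 0 (G.len b.1), Q s ∈ Set.Icc 0 M) :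
    (fun p => Q (leafHeight hb p)) ∈ G.convexClass M := by
  refine ⟨?_, fun P _ s _ => hQ _ (leafHeight_mem hb _)⟩
  rintro P ⟨a, a', -, -, hne, hP0, hPL⟩
  have hexc := isUnitSpeedExcursion_leafHeight hb P
  have hends : leafHeight hb (P.toFun 0) = 0 ∨ leafHeight hb (P.toFun P.length) = 0 := by
    rw [hP0, hPL]
    rcases eq_or_ne (G.vert a) (G.vert b) with ha | ha
    · exact Or.inr (leafHeight_endPt_of_ne hb (ha ▸ hne.symm))
    · exact Or.inl (leafHeight_endPt_of_ne hb ha)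
  have himage : (fun t => leafHeight hb (P.toFun t)) '' Set.Icc 0 P.length ⊆
      Set.Icc 0 (G.len b.1) := Set.image_subset_iff.2 fun t _ => leafHeight_mem hb _
  have himage_convex : Convex ℝ ((fun t => leafHeight hb (P.toFun t)) '' Set.Icc 0 P.length) :=
    (isPreconnected_Icc.image _ hexc.continuousOn).ordConnected.convex
  exact (hconv.subset himage himage_convex).comp (hexc.convexOn hends) (hmono.mono himage)

end MetricGraph

/-! ### A convex potential on an interval with explicit ground state -/

/-- The logarithmic derivative of the ground state `riccatiState`: a polynomial `σ` with
`σ 0 = -a` and `σ' 0 = -κ` whose cubic term lets it vanish at the right end point of an interval. -/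
def riccatiSlope (a κ c s : ℝ) : ℝ := -a - κ * s + c * s ^ 3

/-- The exponential of the primitive of the logarithmic derivative `riccatiSlope`. -/
def riccatiState (a κ c s : ℝ) : ℝ := Real.exp (-a * s - κ * s ^ 2 / 2 + c * s ^ 4 / 4)

/-- The potential `σ' + σ² + (κ - a²)`, with `σ = riccatiSlope a κ c`, for which `riccatiState` is
an eigenfunction with eigenvalue `κ - a²`. The eigenvalue is chosen so that the potential vanishes
at `0`. -/
def riccatiPotential (a κ c s : ℝ) : ℝ := 3 * c * s ^ 2 + riccatiSlope a κ c s ^ 2 - a ^ 2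

section Riccati

variable (a κ c : ℝ)

lemma hasDerivAt_riccatiSlope (s : ℝ) :
    HasDerivAt (riccatiSlope a κ c) (-κ + 3 * c * s ^ 2) s := by
  have h := (((hasDerivAt_id s).const_mul κ).const_sub (-a)).add
    (((hasDerivAt_id s).fun_pow 3).const_mul c)
  exact h.congr_deriv (by simp only [id]; ring)

lemma hasDerivAt_riccatiState (s : ℝ) :
    HasDerivAt (riccatiState a κ c) (riccatiSlope a κ c s * riccatiState a κ c s) s := by
  have h := ((((hasDerivAt_id s).const_mul (-a)).fun_sub
    ((((hasDerivAt_id s).fun_pow 2).const_mul κ).div_const 2)).fun_add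
    ((((hasDerivAt_id s).fun_pow 4).const_mul c).div_const 4)).exp
  exact h.congr_deriv (by simp only [riccatiSlope, riccatiState, id]; ring)

lemma hasDerivAt_riccatiSlope_mul_riccatiState (s : ℝ) :
    HasDerivAt (fun s => riccatiSlope a κ c s * riccatiState a κ c s)
      ((riccatiPotential a κ c s - (κ - a ^ 2)) * riccatiState a κ c s) s :=
  ((hasDerivAt_riccatiSlope a κ c s).fun_mul (hasDerivAt_riccatiState a κ c s)).congr_deriv (by
    simp only [riccatiPotential]
    ring)

lemma hasDerivAt_riccatiPotential (s : ℝ) : HasDerivAt (riccatiPotential a κ c)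
    (6 * c * s + 2 * riccatiSlope a κ c s * (-κ + 3 * c * s ^ 2)) s := by
  have h := ((((hasDerivAt_id s).fun_pow 2).const_mul (3 * c)).fun_add
    ((hasDerivAt_riccatiSlope a κ c s).fun_pow 2)).sub_const (a ^ 2)
  exact h.congr_deriv (by simp only [id]; ring)

lemma hasDerivAt_riccatiPotential_deriv (s : ℝ) :
    HasDerivAt (fun s => 6 * c * s + 2 * riccatiSlope a κ c s * (-κ + 3 * c * s ^ 2))
      (6 * c * (1 + 2 * s * riccatiSlope a κ c s) + 2 * (-κ + 3 * c * s ^ 2) ^ 2) s := by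
  have h := ((hasDerivAt_id s).const_mul (6 * c)).fun_add
    (((hasDerivAt_riccatiSlope a κ c s).const_mul 2).fun_mul
      ((((hasDerivAt_id s).fun_pow 2).const_mul (3 * c)).const_add (-κ)))
  exact h.congr_deriv (by simp only [id]; ring)

lemma continuous_riccatiPotential : Continuous (riccatiPotential a κ c) :=
  continuous_iff_continuousAt.2 fun s => (hasDerivAt_riccatiPotential a κ c s).continuousAt

lemma riccatiPotential_zero : riccatiPotential a κ c 0 = 0 := by
  simp [riccatiPotential, riccatiSlope]

variable {a κ c} {l : ℝ}

lemma riccatiPotential_deriv2_nonneg (ha : 0 ≤ a) (hκ : 0 ≤ κ) (hc : 0 ≤ c)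
    (hsmall : 2 * l * (a + κ * l) ≤ 1) {s : ℝ} (hs : s ∈ Set.Icc 0 l) :
    0 ≤ 6 * c * (1 + 2 * s * riccatiSlope a κ c s) + 2 * (-κ + 3 * c * s ^ 2) ^ 2 := by
  have hs0 : 0 ≤ s := hs.1
  have hslope : -(a + κ * l) ≤ riccatiSlope a κ c s := by
    have h1 : 0 ≤ c * s ^ 3 := by positivity
    have h2 : κ * s ≤ κ * l := mul_le_mul_of_nonneg_left hs.2 hκ
    unfold riccatiSlope
    linarith
  have hfactor : 0 ≤ 1 + 2 * s * riccatiSlope a κ c s := by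
    have h1 : s * -(a + κ * l) ≤ s * riccatiSlope a κ c s := mul_le_mul_of_nonneg_left hslope hs0
    have h2 : s * (a + κ * l) ≤ l * (a + κ * l) :=
      mul_le_mul_of_nonneg_right hs.2 (add_nonneg ha (mul_nonneg hκ (hs0.trans hs.2)))
    linarith
  positivity

lemma convexOn_riccatiPotential (ha : 0 ≤ a) (hκ : 0 ≤ κ) (hc : 0 ≤ c)
    (hsmall : 2 * l * (a + κ * l) ≤ 1) :
    ConvexOn ℝ (Set.Icc 0 l) (riccatiPotential a κ c) :=
  convexOn_of_hasDerivWithinAt2_nonneg (convex_Icc 0 l)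
    (continuous_riccatiPotential a κ c).continuousOn
    (fun s _ => (hasDerivAt_riccatiPotential a κ c s).hasDerivWithinAt)
    (fun s _ => (hasDerivAt_riccatiPotential_deriv a κ c s).hasDerivWithinAt)
    fun _ hs => riccatiPotential_deriv2_nonneg ha hκ hc hsmall (interior_subset hs)

lemma monotoneOn_riccatiPotential (ha : 0 ≤ a) (hκ : 0 ≤ κ) (hc : 0 ≤ c)
    (hsmall : 2 * l * (a + κ * l) ≤ 1) : MonotoneOn (riccatiPotential a κ c) (Set.Icc 0 l) := by
  have hderiv_mono : MonotoneOn
      (fun s => 6 * c * s + 2 * riccatiSlope a κ c s * (-κ + 3 * c * s ^ 2)) (Set.Icc 0 l) :=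
    monotoneOn_of_hasDerivWithinAt_nonneg (convex_Icc 0 l)
      (fun s _ => (hasDerivAt_riccatiPotential_deriv a κ c s).continuousAt.continuousWithinAt)
      (fun s _ => (hasDerivAt_riccatiPotential_deriv a κ c s).hasDerivWithinAt)
      fun _ hs => riccatiPotential_deriv2_nonneg ha hκ hc hsmall (interior_subset hs)
  refine monotoneOn_of_hasDerivWithinAt_nonneg (convex_Icc 0 l)
    (continuous_riccatiPotential a κ c).continuousOn
    (fun s _ => (hasDerivAt_riccatiPotential a κ c s).hasDerivWithinAt) fun s hs => ?_
  have hs' : s ∈ Set.Icc 0 l := interior_subset hs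
  have hderiv_zero : 6 * c * 0 + 2 * riccatiSlope a κ c 0 * (-κ + 3 * c * 0 ^ 2) = 2 * (a * κ) := by
    simp only [riccatiSlope]
    ring
  calc 0 ≤ 2 * (a * κ) := by positivity
    _ ≤ _ := hderiv_zero.symm.trans_le (hderiv_mono ⟨le_rfl, hs'.1.trans hs'.2⟩ hs' hs'.1)

end Riccati

/-- `w`, with derivative `w'`, is a positive solution of `-w'' + Q w = lam w` that satisfies the
Neumann condition at `l` and has the value `1` and the derivative `-a` at `0`. -/
structure IsNeumannGroundState (Q : ℝ → ℝ) (lam a l : ℝ) (w w' : ℝ → ℝ) : Prop where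
  hasDerivAt : ∀ s, HasDerivAt w (w' s) s
  hasDerivAt_deriv : ∀ s, HasDerivAt w' ((Q s - lam) * w s) s
  pos : ∀ s, 0 < w s
  apply_zero : w 0 = 1
  deriv_zero : w' 0 = -a
  deriv_end : w' l = 0

lemma exists_isNeumannGroundState {a lam l M : ℝ} (ha : 0 ≤ a) (hlam : 0 ≤ lam) (hl : 0 < l)
    (hsmall : 2 * l * (a + (lam + a ^ 2) * l) ≤ 1) (hM : 3 * (a + (lam + a ^ 2) * l) ≤ M * l) :
    ∃ Q w w' : ℝ → ℝ, (Continuous Q ∧ Q 0 = 0 ∧ ConvexOn ℝ (Set.Icc 0 l) Q ∧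
      MonotoneOn Q (Set.Icc 0 l) ∧ ∀ s ∈ Set.Icc 0 l, Q s ∈ Set.Icc 0 M) ∧
      IsNeumannGroundState Q lam a l w w' := by
  set κ := lam + a ^ 2 with hκ_def
  have hκ : 0 ≤ κ := by positivity
  obtain ⟨c, hc⟩ : ∃ c, c * l ^ 3 = a + κ * l := ⟨(a + κ * l) / l ^ 3, by field_simp⟩
  have hc0 : 0 ≤ c := nonneg_of_mul_nonneg_left (hc ▸ by positivity) (pow_pos hl 3)
  have hslope_end : riccatiSlope a κ c l = 0 := by
    rw [riccatiSlope, hc]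
    ring
  have hmono := monotoneOn_riccatiPotential ha hκ hc0 hsmall
  have hend : riccatiPotential a κ c l ≤ M := by
    have hcl : 3 * c * l ^ 2 ≤ M := le_of_mul_le_mul_right (by linarith) hl
    rw [riccatiPotential, hslope_end]
    linarith [sq_nonneg a]
  refine ⟨riccatiPotential a κ c, riccatiState a κ c,
    fun s => riccatiSlope a κ c s * riccatiState a κ c s,
    ⟨continuous_riccatiPotential a κ c, riccatiPotential_zero a κ c,
      convexOn_riccatiPotential ha hκ hc0 hsmall, hmono, fun s hs => ⟨?_, ?_⟩⟩, ?_⟩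
  · rw [← riccatiPotential_zero a κ c]
    exact hmono ⟨le_rfl, hl.le⟩ hs hs.1
  · exact (hmono hs ⟨hl.le, le_rfl⟩ hs.2).trans hend
  · refine ⟨hasDerivAt_riccatiState a κ c, fun s => ?_, fun _ => Real.exp_pos _,
      by simp [riccatiState], by simp [riccatiState, riccatiSlope], by simp [hslope_end]⟩
    simpa [hκ_def] using hasDerivAt_riccatiSlope_mul_riccatiState a κ c s

/-! ### The Helmholtz equation -/

/-- The solution of `-f'' = k² f` with boundary values `A` at `0` and `B` at `l`. -/
def helmholtzInterpolation (k l A B t : ℝ) : ℝ :=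
  (A * Real.sin (k * (l - t)) + B * Real.sin (k * t)) / Real.sin (k * l)

/-- The derivative of `helmholtzInterpolation`. -/
def helmholtzInterpolationDeriv (k l A B t : ℝ) : ℝ :=
  k * (B * Real.cos (k * t) - A * Real.cos (k * (l - t))) / Real.sin (k * l)

section Interpolation

variable (k l A B : ℝ)

lemma hasDerivAt_helmholtzInterpolation (t : ℝ) : HasDerivAt (helmholtzInterpolation k l A B)
    (helmholtzInterpolationDeriv k l A B t) t := by
  have hright : HasDerivAt (fun t => k * t) k t := by simpa using (hasDerivAt_id t).const_mul k
  have hleft : HasDerivAt (fun t => k * (l - t)) (-k) t := by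
    simpa using ((hasDerivAt_id t).const_sub l).const_mul k
  refine (((hleft.sin.const_mul A).fun_add (hright.sin.const_mul B)).div_const _).congr_deriv ?_
  simp only [helmholtzInterpolationDeriv]
  ring

lemma hasDerivAt_helmholtzInterpolationDeriv (t : ℝ) :
    HasDerivAt (helmholtzInterpolationDeriv k l A B) (-k ^ 2 * helmholtzInterpolation k l A B t)
      t := by
  have hright : HasDerivAt (fun t => k * t) k t := by simpa using (hasDerivAt_id t).const_mul k
  have hleft : HasDerivAt (fun t => k * (l - t)) (-k) t := by
    simpa using ((hasDerivAt_id t).const_sub l).const_mul k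
  refine ((((hright.cos.const_mul B).fun_sub (hleft.cos.const_mul A)).const_mul k).div_const
    _).congr_deriv ?_
  simp only [helmholtzInterpolation]
  ring

variable {k l A B}

lemma helmholtzInterpolation_pos (hk : 0 < k) (hkl : k * l < Real.pi) (hA : 0 < A) (hB : 0 < B)
    {t : ℝ} (ht : t ∈ Set.Icc 0 l) (hl : 0 < l) : 0 < helmholtzInterpolation k l A B t := by
  have hsin : 0 < Real.sin (k * l) := Real.sin_pos_of_pos_of_lt_pi (mul_pos hk hl) hkl
  have hright : 0 ≤ Real.sin (k * t) := Real.sin_nonneg_of_nonneg_of_le_pi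
    (mul_nonneg hk.le ht.1) ((mul_le_mul_of_nonneg_left ht.2 hk.le).trans hkl.le)
  refine div_pos ?_ hsin
  rcases ht.2.lt_or_eq with htl | rfl
  · have hleft : 0 < Real.sin (k * (l - t)) :=
      Real.sin_pos_of_pos_of_lt_pi (mul_pos hk (sub_pos.2 htl))
        ((mul_le_mul_of_nonneg_left (sub_le_self l ht.1) hk.le).trans_lt hkl)
    positivity
  · rw [sub_self, mul_zero, Real.sin_zero, mul_zero, zero_add]
    positivity

end Interpolation

namespace MetricGraph

variable {V E : Type*} (G : MetricGraph V E)

/-- The derivative, away from the end `a` of an edge, of the solution of `-f'' = k² f` on this edge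
as a linear function of its vertex values. Written with `sinc`, it makes sense also for `k = 0`. -/
def outDeriv (k : ℝ) (a : E × Bool) : (V → ℝ) →ₗ[ℝ] ℝ :=
  (G.len a.1 * Real.sinc (k * G.len a.1))⁻¹ •
    (LinearMap.proj (G.vert (otherEnd a)) - Real.cos (k * G.len a.1) • LinearMap.proj (G.vert a))

lemma outDeriv_apply (k : ℝ) (a : E × Bool) (x : V → ℝ) : G.outDeriv k a x =
    (x (G.vert (otherEnd a)) - Real.cos (k * G.len a.1) * x (G.vert a)) /
      (G.len a.1 * Real.sinc (k * G.len a.1)) := by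
  simp only [outDeriv, LinearMap.smul_apply, LinearMap.sub_apply, LinearMap.proj_apply,
    smul_eq_mul, div_eq_inv_mul]

lemma outDeriv_zero_apply (a : E × Bool) (x : V → ℝ) :
    G.outDeriv 0 a x = (x (G.vert (otherEnd a)) - x (G.vert a)) / G.len a.1 := by
  simp [outDeriv_apply]

lemma outDeriv_zero_one (a : E × Bool) : G.outDeriv 0 a 1 = 0 := by
  simp [outDeriv_zero_apply]

lemma outDeriv_nonneg_of_pos {k : ℝ} (hk : 0 < k) {e : E} (hkl : k * G.len e < Real.pi)
    {x : V → ℝ} (hx : ∀ v, 0 ≤ x v) :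
    0 ≤ G.outDeriv k (e, false) x + G.outDeriv k (e, true) x := by
  have hpos : 0 < k * G.len e := mul_pos hk (G.len_pos e)
  have hsinc : 0 ≤ Real.sinc (k * G.len e) := by
    rw [Real.sinc_of_ne_zero hpos.ne']
    exact div_nonneg (Real.sin_nonneg_of_nonneg_of_le_pi hpos.le hkl.le) hpos.le
  have hsum : G.outDeriv k (e, false) x + G.outDeriv k (e, true) x =
      (1 - Real.cos (k * G.len e)) * (x (G.vert (e, false)) + x (G.vert (e, true))) /
        (G.len e * Real.sinc (k * G.len e)) := by
    simp only [outDeriv_apply, otherEnd, Bool.not_false, Bool.not_true]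
    ring
  rw [hsum]
  exact div_nonneg (mul_nonneg (sub_nonneg.2 (Real.cos_le_one _)) (add_nonneg (hx _) (hx _)))
    (mul_nonneg (G.len_nonneg e) hsinc)

lemma continuousAt_outDeriv {x : ℝ → V → ℝ} (hx : ContinuousAt x 0) (a : E × Bool) :
    ContinuousAt (fun k => G.outDeriv k a (x k)) 0 := by
  have hcos : Continuous fun k => Real.cos (k * G.len a.1) := by fun_prop
  have hsinc : Continuous fun k => G.len a.1 * Real.sinc (k * G.len a.1) :=
    continuous_const.mul (Real.continuous_sinc.comp (continuous_id.mul continuous_const))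
  simp only [outDeriv_apply]
  exact ((continuousAt_pi.1 hx _).sub (hcos.continuousAt.mul (continuousAt_pi.1 hx _))).div
    hsinc.continuousAt (by simpa using (G.len_pos a.1).ne')

/-- The function on the edges that solves `-f'' = k² f` and has vertex values `x`. -/
def helmholtzExtension (k : ℝ) (x : V → ℝ) (e : E) : ℝ → ℝ :=
  helmholtzInterpolation k (G.len e) (x (G.vert (e, false))) (x (G.vert (e, true)))

/-- The derivative of `helmholtzExtension`. -/
def helmholtzExtensionDeriv (k : ℝ) (x : V → ℝ) (e : E) : ℝ → ℝ :=
  helmholtzInterpolationDeriv k (G.len e) (x (G.vert (e, false))) (x (G.vert (e, true)))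

lemma helmholtzExtension_endCoord {k : ℝ} (x : V → ℝ) {a : E × Bool}
    (hsin : Real.sin (k * G.len a.1) ≠ 0) :
    G.helmholtzExtension k x a.1 (G.endCoord a) = x (G.vert a) := by
  obtain ⟨e, _ | _⟩ := a <;>
    simp [helmholtzExtension, helmholtzInterpolation, endCoord, mul_div_cancel_right₀ _ hsin]

lemma normalDeriv_helmholtzExtensionDeriv {k : ℝ} (x : V → ℝ) {a : E × Bool}
    (hsin : Real.sin (k * G.len a.1) ≠ 0) :
    G.normalDeriv (G.helmholtzExtensionDeriv k x) a = -G.outDeriv k a x := by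
  have hkl : k * G.len a.1 ≠ 0 := fun h => hsin (by rw [h, Real.sin_zero])
  have hk : k ≠ 0 := left_ne_zero_of_mul hkl
  have hl : G.len a.1 ≠ 0 := right_ne_zero_of_mul hkl
  have hsinc : G.len a.1 * Real.sinc (k * G.len a.1) = Real.sin (k * G.len a.1) / k := by
    rw [Real.sinc_of_ne_zero hkl]
    field_simp
  rw [outDeriv_apply, hsinc, div_div_eq_mul_div]
  obtain ⟨e, _ | _⟩ := a
  all_goals
    simp only [normalDeriv, helmholtzExtensionDeriv, helmholtzInterpolationDeriv, otherEnd,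
      Bool.not_false, Bool.not_true, mul_zero, sub_zero, sub_self, Real.cos_zero, mul_one]
    ring

/-! ### Vertex values close to a constant -/

lemma eq_of_connected (hconn : (SimpleGraph.fromEdgeSet (Set.range G.edgeEnds)).Connected)
    {X : Type*} {x : V → X} (hx : ∀ e, x (G.vert (e, false)) = x (G.vert (e, true))) (v w : V) :
    x v = x w := by
  obtain ⟨p⟩ := hconn.preconnected v w
  induction p with
  | nil => rfl
  | cons h _ ih =>
    obtain ⟨⟨e, he⟩, -⟩ := (SimpleGraph.fromEdgeSet_adj _).1 h
    rw [← ih]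
    rcases Sym2.eq_iff.1 he with ⟨hu, hw⟩ | ⟨hu, hw⟩
    · rw [← hu, ← hw, hx]
    · rw [← hu, ← hw, hx]

variable [Fintype E]

lemma sum_mul_outDeriv_zero (x : V → ℝ) : ∑ a, x (G.vert a) * G.outDeriv 0 a x =
    -∑ e, (x (G.vert (e, false)) - x (G.vert (e, true))) ^ 2 / G.len e := by
  rw [sum_ends_eq, ← Finset.sum_neg_distrib]
  refine Finset.sum_congr rfl fun e _ => ?_
  simp only [outDeriv_zero_apply, otherEnd, Bool.not_false, Bool.not_true]
  ring

variable [DecidableEq V]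

/-- The operator of the boundary value problem for the vertex values of a solution of the Helmholtz
equation `-u'' = k² u` with Dirichlet conditions in `S` and Kirchhoff conditions outside `S`. -/
def mixedOperator (S : Finset V) (k : ℝ) : (V → ℝ) →ₗ[ℝ] (V → ℝ) :=
  LinearMap.pi fun v =>
    if v ∈ S then LinearMap.proj v else ∑ a : E × Bool with G.vert a = v, G.outDeriv k a

variable {G} {S : Finset V} {v : V}

lemma mixedOperator_apply_of_mem (hv : v ∈ S) (k : ℝ) (x : V → ℝ) :
    G.mixedOperator S k x v = x v := by
  simp [mixedOperator, hv]

lemma mixedOperator_apply_of_notMem (hv : v ∉ S) (k : ℝ) (x : V → ℝ) :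
    G.mixedOperator S k x v = ∑ a : E × Bool with G.vert a = v, G.outDeriv k a x := by
  simp [mixedOperator, hv]

lemma eq_zero_of_mixedOperator_zero_eq_zero
    (hconn : (SimpleGraph.fromEdgeSet (Set.range G.edgeEnds)).Connected) (hS : S.Nonempty)
    {x : V → ℝ} (hx : G.mixedOperator S 0 x = 0) : x = 0 := by
  have := G.finite_vertices
  have := Fintype.ofFinite V
  have hboundary : ∀ v ∈ S, x v = 0 := fun v hv =>
    (mixedOperator_apply_of_mem hv 0 x).symm.trans (congrFun hx v)
  have henergy : ∑ e, (x (G.vert (e, false)) - x (G.vert (e, true))) ^ 2 / G.len e = 0 := by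
    rw [← neg_eq_zero, ← sum_mul_outDeriv_zero, sum_vert_mul]
    refine Finset.sum_eq_zero fun v _ => ?_
    by_cases hv : v ∈ S
    · rw [hboundary v hv, zero_mul]
    · rw [← mixedOperator_apply_of_notMem hv, hx, Pi.zero_apply, mul_zero]
  have hedge : ∀ e, x (G.vert (e, false)) = x (G.vert (e, true)) := fun e => by
    have hsq := (Finset.sum_eq_zero_iff_of_nonneg
      fun e _ => div_nonneg (sq_nonneg _) (G.len_nonneg e)).1 henergy e (Finset.mem_univ e)
    simpa [sub_eq_zero, (G.len_pos e).ne'] using hsq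
  obtain ⟨w, hw⟩ := hS
  exact funext fun v => (G.eq_of_connected hconn hedge v w).trans (hboundary w hw)

lemma exists_vertexValues (hconn : (SimpleGraph.fromEdgeSet (Set.range G.edgeEnds)).Connected)
    (hS : S.Nonempty) : ∃ x : ℝ → V → ℝ, ContinuousAt x 0 ∧ x 0 = 1 ∧
      ∀ᶠ k in nhds 0, (∀ v ∈ S, x k v = 1) ∧
        ∀ v ∉ S, ∑ a : E × Bool with G.vert a = v, G.outDeriv k a (x k) = 0 := by
  have := G.finite_vertices
  have := Fintype.ofFinite V
  let A : ℝ → Matrix V V ℝ := fun k => LinearMap.toMatrix' (G.mixedOperator S k)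
  let r : V → ℝ := fun v => if v ∈ S then 1 else 0
  have hA : ContinuousAt A 0 := by
    refine continuousAt_pi.2 fun v => continuousAt_pi.2 fun w => ?_
    simp only [A, LinearMap.toMatrix'_apply]
    by_cases hv : v ∈ S
    · simpa only [mixedOperator_apply_of_mem hv] using continuousAt_const
    · simp only [mixedOperator_apply_of_notMem hv]
      exact tendsto_finsetSum _ fun a _ => G.continuousAt_outDeriv continuousAt_const a
  have hone : (A 0).mulVec 1 = r := by
    rw [LinearMap.toMatrix'_mulVec]
    funext v
    by_cases hv : v ∈ S
    · simp [r, hv, mixedOperator_apply_of_mem]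
    · simp [r, hv, mixedOperator_apply_of_notMem, outDeriv_zero_one]
  have hdet : (A 0).det ≠ 0 := fun h => by
    obtain ⟨x, hx0, hx⟩ := Matrix.exists_mulVec_eq_zero_iff.2 h
    rw [LinearMap.toMatrix'_mulVec] at hx
    exact hx0 (eq_zero_of_mixedOperator_zero_eq_zero hconn hS hx)
  obtain ⟨x, hxc, hx0, hx⟩ := exists_continuousAt_mulVec_eq hA hdet hone
  refine ⟨x, hxc, hx0, hx.mono fun k hk => ?_⟩
  rw [LinearMap.toMatrix'_mulVec] at hk
  refine ⟨fun v hv => ?_, fun v hv => ?_⟩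
  · exact (mixedOperator_apply_of_mem hv k (x k)).symm.trans ((congrFun hk v).trans (if_pos hv))
  · exact (mixedOperator_apply_of_notMem hv k (x k)).symm.trans
      ((congrFun hk v).trans (if_neg hv))

end MetricGraph

/-! ### Gluing along a leaf edge -/

namespace MetricGraph

variable {V E : Type*} {G : MetricGraph V E} [DecidableEq E] {b : E × Bool} {k : ℝ} {x : V → ℝ}
  {Q w w' : ℝ → ℝ}

variable (G b k x w) in
/-- The solution of `-u'' = k² u` with vertex values `x`, with its restriction to the edge of the
end `b` replaced by `w`, as a function of the distance to the end of this edge opposite to `b`. -/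
def leafModification (e : E) : ℝ → ℝ :=
  Function.update (G.helmholtzExtension k x) b.1 (fun t => w (G.coordFrom (otherEnd b) t)) e

variable (G b k x w') in
/-- The derivative of `leafModification`, `w'` being the derivative of `w`. -/
def leafModificationDeriv (e : E) : ℝ → ℝ :=
  Function.update (G.helmholtzExtensionDeriv k x) b.1
    (fun t => w' (G.coordFrom (otherEnd b) t) * orientation (otherEnd b)) e

lemma hasDerivAt_leafModification (hw : ∀ s, HasDerivAt w (w' s) s) (e : E) (t : ℝ) :
    HasDerivAt (G.leafModification b k x w e) (G.leafModificationDeriv b k x w' e t) t := by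
  by_cases he : e = b.1
  · subst he
    rw [leafModification, leafModificationDeriv, Function.update_self, Function.update_self]
    exact (hw _).comp t (G.hasDerivAt_coordFrom _ t)
  · rw [leafModification, leafModificationDeriv, Function.update_of_ne he,
      Function.update_of_ne he]
    exact hasDerivAt_helmholtzInterpolation _ _ _ _ t

lemma normalDeriv_leafModificationDeriv_of_ne (hsin : ∀ e, Real.sin (k * G.len e) ≠ 0)
    {a : E × Bool} (hab : a.1 ≠ b.1) :
    G.normalDeriv (G.leafModificationDeriv b k x w') a = -G.outDeriv k a x := by
  rw [← G.normalDeriv_helmholtzExtensionDeriv x (hsin a.1), normalDeriv_eq, normalDeriv_eq,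
    leafModificationDeriv, Function.update_of_ne hab]

lemma normalDeriv_leafModificationDeriv_otherEnd :
    G.normalDeriv (G.leafModificationDeriv b k x w') (otherEnd b) = -w' 0 := by
  rw [normalDeriv_eq, leafModificationDeriv, otherEnd_fst, Function.update_self,
    coordFrom_endCoord, mul_left_comm, orientation_mul_self, mul_one]

lemma normalDeriv_leafModificationDeriv_self (hw' : w' (G.len b.1) = 0) :
    G.normalDeriv (G.leafModificationDeriv b k x w') b = 0 := by
  rw [normalDeriv_eq, leafModificationDeriv, Function.update_self, coordFrom_otherEnd_endCoord,
    hw', zero_mul, mul_zero, neg_zero]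

lemma leafModification_pos (hk : 0 < k) (hkl : ∀ e, k * G.len e < Real.pi) (hx : ∀ v, 0 < x v)
    (hw : ∀ s, 0 < w s) (e : E) {t : ℝ} (ht : t ∈ Set.Icc 0 (G.len e)) :
    0 < G.leafModification b k x w e t := by
  by_cases he : e = b.1
  · subst he
    rw [leafModification, Function.update_self]
    exact hw _
  · rw [leafModification, Function.update_of_ne he]
    exact helmholtzInterpolation_pos hk (hkl e) (hx _) (hx _) ht (G.len_pos e)

variable [Fintype E]

variable (G) in
/-- The total derivative, away from the ends of the edges other than `e`, of the solution of
`-u'' = k² u` with vertex values `x`. If Kirchhoff's condition holds outside the vertices of `e`,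
this is what the derivatives on `e` have to balance. -/
def outerFlux (e : E) (k : ℝ) (x : V → ℝ) : ℝ :=
  ∑ a : E × Bool with a.1 ≠ e, G.outDeriv k a x

lemma outerFlux_zero_one (e : E) : G.outerFlux e 0 1 = 0 :=
  Finset.sum_eq_zero fun a _ => G.outDeriv_zero_one a

lemma continuousAt_outerFlux (e : E) {x : ℝ → V → ℝ} (hx : ContinuousAt x 0) :
    ContinuousAt (fun k => G.outerFlux e k (x k)) 0 :=
  tendsto_finsetSum _ fun a _ => G.continuousAt_outDeriv hx a

lemma outerFlux_nonneg (e : E) (hk : 0 < k) (hkl : ∀ e, k * G.len e < Real.pi)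
    (hx : ∀ v, 0 ≤ x v) : 0 ≤ G.outerFlux e k x := by
  rw [outerFlux, Finset.sum_filter, sum_ends_eq]
  refine Finset.sum_nonneg fun e' _ => ?_
  dsimp only
  split_ifs
  · exact G.outDeriv_nonneg_of_pos hk (hkl e') hx
  · exact (add_zero 0).ge

variable [DecidableEq V]

lemma leafModification_endCoord (hb : G.IsLeaf (G.vert b))
    (hsin : ∀ e, Real.sin (k * G.len e) ≠ 0) (hx : w 0 = x (G.vert (otherEnd b))) (a : E × Bool) :
    G.leafModification b k x w a.1 (G.endCoord a) =
      Function.update x (G.vert b) (w (G.len b.1)) (G.vert a) := by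
  by_cases hab : a.1 = b.1
  · rw [leafModification, hab, Function.update_self]
    rcases eq_or_eq_otherEnd hab with rfl | rfl
    · rw [coordFrom_otherEnd_endCoord, Function.update_self]
    · rw [coordFrom_endCoord, Function.update_of_ne hb.vert_otherEnd_ne, hx]
  · rw [leafModification, Function.update_of_ne hab, helmholtzExtension_endCoord _ _ (hsin _),
      Function.update_of_ne (hb.vert_ne hab)]

lemma hasDerivAt_leafModificationDeriv (hb : G.IsLeaf (G.vert b)) (hQ0 : Q 0 = 0)
    (hw' : ∀ s, HasDerivAt w' ((Q s - k ^ 2) * w s) s) (e : E) {t : ℝ}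
    (ht : t ∈ Set.Icc 0 (G.len e)) : HasDerivAt (G.leafModificationDeriv b k x w' e)
      ((G.onEdge (fun p => Q (leafHeight hb p)) e t - k ^ 2) * G.leafModification b k x w e t)
      t := by
  rw [onEdge_of_mem _ _ _ ht, leafModification, leafModificationDeriv]
  by_cases he : e = b.1
  · subst he
    rw [Function.update_self, Function.update_self, leafHeight_pt]
    refine (((hw' _).comp t (G.hasDerivAt_coordFrom _ t)).mul_const _).congr_deriv ?_
    rw [mul_assoc, orientation_mul_self, mul_one]
  · rw [Function.update_of_ne he, Function.update_of_ne he, leafHeight_pt_of_ne hb he, hQ0,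
      zero_sub]
    exact hasDerivAt_helmholtzInterpolationDeriv _ _ _ _ t

lemma IsLeaf.sum_fiber_eq_zero (hb : G.IsLeaf (G.vert b)) {w m : E × Bool → ℝ} (hwb : w b = 0)
    (hwb' : w (otherEnd b) = ∑ a : E × Bool with a.1 ≠ b.1, m a)
    (hwm : ∀ a, a.1 ≠ b.1 → w a = -m a)
    (hm : ∀ v, v ≠ G.vert b → v ≠ G.vert (otherEnd b) →
      ∑ a : E × Bool with G.vert a = v, m a = 0) (v : V) :
    ∑ a : E × Bool with G.vert a = v, w a = 0 := by
  refine sum_fiber_eq_zero_of_forall_ne (v₀ := G.vert (otherEnd b)) ?_ (fun v hv => ?_) v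
  · have hb' : b ≠ otherEnd b := fun h => hb.vert_otherEnd_ne (congrArg G.vert h.symm)
    have hfilter : Finset.univ.filter (fun a : E × Bool => ¬a.1 ≠ b.1) = {b, otherEnd b} := by
      ext a
      simp only [ne_eq, not_not, Finset.mem_filter, Finset.mem_univ, true_and, Finset.mem_insert,
        Finset.mem_singleton]
      exact ⟨eq_or_eq_otherEnd, fun h => h.elim (congrArg Prod.fst) (congrArg Prod.fst)⟩
    rw [← Finset.sum_filter_add_sum_filter_not Finset.univ (fun a : E × Bool => a.1 ≠ b.1),
      hfilter, Finset.sum_pair hb', hwb, hwb', zero_add, ← Finset.sum_add_distrib]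
    exact Finset.sum_eq_zero fun a ha => by rw [hwm a (Finset.mem_filter.1 ha).2, neg_add_cancel]
  · rcases eq_or_ne v (G.vert b) with rfl | hvb
    · rw [hb.filter_vert_eq, Finset.sum_singleton, hwb]
    · rw [Finset.sum_congr rfl fun a ha => hwm a ?_, Finset.sum_neg_distrib, hm v hvb hv, neg_zero]
      intro hab
      obtain rfl := (Finset.mem_filter.1 ha).2
      rcases eq_or_eq_otherEnd hab with rfl | rfl
      exacts [hvb rfl, hv rfl]

lemma exists_pos_mem_eigenspace (hb : G.IsLeaf (G.vert b)) (hk : 0 < k)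
    (hkl : ∀ e, k * G.len e < Real.pi) (hx : ∀ v, 0 < x v) (hxb : x (G.vert (otherEnd b)) = 1)
    (hkir : ∀ v, v ≠ G.vert b → v ≠ G.vert (otherEnd b) →
      ∑ a : E × Bool with G.vert a = v, G.outDeriv k a x = 0)
    (hQ : Continuous Q) (hQ0 : Q 0 = 0)
    (hw : IsNeumannGroundState Q (k ^ 2) (G.outerFlux b.1 k x) (G.len b.1) w w') :
    ∃ phi ∈ G.eigenspace (fun p => Q (leafHeight hb p)) (k ^ 2), ∀ p, 0 < phi p := by
  have hsin : ∀ e, Real.sin (k * G.len e) ≠ 0 := fun e =>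
    (Real.sin_pos_of_pos_of_lt_pi (mul_pos hk (G.len_pos e)) (hkl e)).ne'
  have hends := leafModification_endCoord hb hsin (hw.apply_zero.trans hxb.symm)
  refine ⟨G.glue _ hends, (mem_eigenspace_iff_exists_isClassicalSolution
    (hQ.comp (continuous_leafHeight hb))).2 ⟨_, isClassicalSolution_glue hends
      (fun e t _ => (hasDerivAt_leafModification hw.hasDerivAt e t).hasDerivWithinAt)
      (fun e t ht => (hasDerivAt_leafModificationDeriv hb hQ0 hw.hasDerivAt_deriv e
        ht).hasDerivWithinAt) ?_⟩, fun p => ?_⟩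
  · refine hb.sum_fiber_eq_zero (normalDeriv_leafModificationDeriv_self hw.deriv_end) ?_
      (fun a => normalDeriv_leafModificationDeriv_of_ne hsin) hkir
    rw [normalDeriv_leafModificationDeriv_otherEnd, hw.deriv_zero, neg_neg, outerFlux]
  · obtain ⟨e, t, rfl⟩ := G.exists_eq_pt p
    exact leafModification_pos hk hkl hx hw.pos e t.2

/-! ### Convex potentials supported on a leaf edge -/

lemma exists_potential_mem_convexClass
    (hconn : (SimpleGraph.fromEdgeSet (Set.range G.edgeEnds)).Connected)
    (hb : G.IsLeaf (G.vert b)) {M : ℝ} (hM : 0 < M) :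
    ∃ Q : ℝ → ℝ, Continuous Q ∧ Q 0 = 0 ∧ (fun p => Q (leafHeight hb p)) ∈ G.convexClass M ∧
      ∃ lam > 0, ∃ phi ∈ G.eigenspace (fun p => Q (leafHeight hb p)) lam, ∀ p, 0 < phi p := by
  have := G.finite_vertices
  obtain ⟨x, hxc, hx0, hx⟩ := exists_vertexValues hconn
    (Finset.insert_nonempty (G.vert b) {G.vert (otherEnd b)})
  have hl : 0 < G.len b.1 := G.len_pos b.1
  let m : ℝ → ℝ := fun k => G.outerFlux b.1 k (x k) +
    (k ^ 2 + G.outerFlux b.1 k (x k) ^ 2) * G.len b.1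
  have hm : Filter.Tendsto m (nhds 0) (nhds 0) := by
    have hflux := continuousAt_outerFlux (G := G) b.1 hxc
    have hcont : ContinuousAt m 0 :=
      hflux.add (((continuousAt_id.pow 2).add (hflux.pow 2)).mul continuousAt_const)
    simpa [ContinuousAt, m, hx0, outerFlux_zero_one] using hcont
  have hsmall : ∀ {c r : ℝ}, 0 < r → ∀ᶠ k in nhds 0, c * m k < r := fun hr =>
    (hm.const_mul _).eventually_lt_const (by simpa using hr)
  have hxpos : ∀ᶠ k in nhds 0, ∀ v, 0 < x k v := Filter.eventually_all.2 fun v =>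
    (continuousAt_pi.1 hxc v).eventually_const_lt (by simp [hx0])
  have hkl : ∀ᶠ k in nhds 0, ∀ e, k * G.len e < Real.pi := Filter.eventually_all.2 fun e =>
    (continuousAt_id.mul continuousAt_const).eventually_lt_const (by simpa using Real.pi_pos)
  obtain ⟨k, ⟨⟨hxb, hkir⟩, hml, hmM, hxpos, hkl⟩, hk : 0 < k⟩ := (((hx.and <|
    (hsmall one_pos).and <| (hsmall (mul_pos hM hl)).and <| hxpos.and hkl).filter_mono
      nhdsWithin_le_nhds).and (self_mem_nhdsWithin (s := Set.Ioi 0))).exists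
  obtain ⟨Q, w, w', ⟨hQ, hQ0, hQconv, hQmono, hQmem⟩, hw⟩ := exists_isNeumannGroundState
    (outerFlux_nonneg b.1 hk hkl fun v => (hxpos v).le) (sq_nonneg k) hl hml.le hmM.le
  exact ⟨Q, hQ, hQ0, comp_leafHeight_mem_convexClass hb hQconv hQmono hQmem, k ^ 2,
    sq_pos_of_pos hk, exists_pos_mem_eigenspace hb hk hkl hxpos (hxb _ (by simp))
      (fun v hvb hvb' => hkir v (by simp [hvb, hvb'])) hQ hQ0 hw⟩

end MetricGraph

namespace MetricGraph

variable {V E : Type*} {G : MetricGraph V E} [Fintype E] [DecidableEq V]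

lemma IsTree.exists_isLeaf (hG : G.IsTree) : ∃ v, G.IsLeaf v := by
  classical
  have := G.finite_vertices
  have := Fintype.ofFinite V
  obtain ⟨v⟩ := hG.isTree.connected.nonempty
  obtain ⟨⟨e, -⟩, -⟩ := G.vert_surjective v
  have : Nontrivial V := ⟨_, _, hG.loopless e⟩
  have hends : ∀ a : E × Bool, G.edgeEnds a.1 = s(G.vert a, G.vert (otherEnd a)) := by
    rintro ⟨e, _ | _⟩
    exacts [rfl, Sym2.eq_swap]
  have hne : ∀ a : E × Bool, G.vert a ≠ G.vert (otherEnd a) := by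
    rintro ⟨e, _ | _⟩
    exacts [hG.loopless e, (hG.loopless e).symm]
  obtain ⟨w, hw⟩ := hG.isTree.exists_vert_degree_one_of_nontrivial
  obtain ⟨z, -, hz⟩ := SimpleGraph.degree_eq_one_iff_existsUnique_adj.1 hw
  have hother : ∀ a, G.vert a = w → G.vert (otherEnd a) = z := by
    rintro a rfl
    exact hz _ ((SimpleGraph.fromEdgeSet_adj _).2 ⟨⟨a.1, hends a⟩, hne a⟩)
  obtain ⟨b, hb⟩ := G.vert_surjective w
  refine ⟨w, Finset.card_eq_one.2 ⟨b, Finset.eq_singleton_iff_unique_mem.2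
    ⟨Finset.mem_filter.2 ⟨Finset.mem_univ b, hb⟩, fun a ha => ?_⟩⟩⟩
  have ha : G.vert a = w := (Finset.mem_filter.1 ha).2
  have hedge : a.1 = b.1 :=
    hG.no_parallel (by rw [hends, hends, ha, hb, hother a ha, hother b hb])
  refine (eq_or_eq_otherEnd hedge).resolve_right fun h => hne b ?_
  rw [hb, ← ha, h]

end MetricGraph

end

open MetricGraph in
theorem mainTheorem7_general {V E : Type*} [Fintype E] [DecidableEq V] (G : MetricGraph V E)
    (hconn : (SimpleGraph.fromEdgeSet (Set.range G.edgeEnds)).Connected) (hleaf : ∃ v, G.IsLeaf v)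
    (hmult : 2 ≤ G.multiplicity 0 (G.eigenvalue 0 2)) (M : ℝ) (hM : 0 < M) :
    ¬ IsMinOn G.fundamentalGap (G.convexClass M) 0 := by
  classical
  obtain ⟨v, hv⟩ := hleaf
  obtain ⟨b, rfl⟩ := G.vert_surjective v
  obtain ⟨Q, hQ, hQ0, hQM, lam, hlam, phi, hphi, hpos⟩ :=
    exists_potential_mem_convexClass hconn hv hM
  obtain ⟨u, hu, hu0, hub⟩ := exists_mem_eigenspace_apply_eq_zero hmult (G.endPt b)
  have hedge : Set.EqOn (G.onEdge u b.1) 0 (Set.Icc 0 (G.len b.1)) :=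
    hv.eqOn_zero_of_mem_eigenspace continuous_const hu hub
  have hmul : ∀ p, Q (leafHeight hv p) * u p = (0 : G.Point → ℝ) p * u p := fun p => by
    obtain ⟨e, x, rfl⟩ := G.exists_eq_pt p
    rcases eq_or_ne e b.1 with rfl | he
    · have hux : u (G.pt b.1 x) = 0 := (G.onEdge_of_mem u b.1 x.2).symm.trans (hedge x.2)
      rw [hux, mul_zero, mul_zero]
    · rw [leafHeight_pt_of_ne hv he, hQ0, Pi.zero_apply]
  exact fun hmin => (hmin hQM).not_gt (fundamentalGap_lt_of_pos
    (hQ.comp (continuous_leafHeight hv)) hlam hphi hpos (mem_eigenspace_of_mul_eq hmul hu) hu0 hub)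

theorem mainTheorem7 {V E : Type*} [Fintype E] [DecidableEq V] (G : MetricGraph V E)
    (hG : G.IsTree) (hmult : 2 ≤ G.multiplicity 0 (G.eigenvalue 0 2)) (M : ℝ) (hM : 0 < M) :
    ¬ IsMinOn G.fundamentalGap (G.convexClass M) 0 :=
  mainTheorem7_general G hG.isTree.connected hG.exists_isLeaf hmult M hM
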